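/- Let $p$ be a prime, let $k$ be an algebraically closed field of characteristic $p$, let $K_0=\mathrm{Frac}(W(k))$ be the fraction field of the ring of Witt vectors of $k$, and fix an algebraic closure of $K_0$. For $n\ge 1$ let $K_n=K_0(\zeta_{p^n})$, where $\zeta_{p^n}$ is a primitive $p^n$-th root of unity, and let $v_n$ be the valuation on $K_n$ normalized so that uniformizers have valuation $1$ (and $v_n(0)=\infty$). For a finite Galois extension $L/K_0$ with group $G$ and normalized valuation $v_L$, let $G_i$ ($i\in\mathbb{R}_{\ge 0}$) be the higher ramification groups in the lower numbering, $G_i=\{g\in G: v_L(gx-x)\ge i+1 \text{ for all } x \text{ in the ring of integers of } L\}$. Let $\phi(u)=\int_0^u \frac{dt}{[G_0:G_t]}$ for $u\ge 0$, let $\psi:[0,\infty)\to[0,\infty)$ be the inverse of $\phi$, and let $G^i=G_{\psi(i)}$ be the higher ramification groups in the upper numbering. The conductor of $L/K_0$ is $h_{L/K_0}=\sup\{i\in[0,\infty): G^i\ne\{\mathrm{id}\}\}$ (with $h_{L/K_0}=0$ if $L=K_0$). Let $\ell\ge 1$, $c\ge 1$ and $d\ge\max(\ell,c)$ be integers. Let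 $\alpha\in K_\ell$ with $v_\ell(\alpha)\ge 0$, and write $\alpha=1+t_\alpha$. Let $\sqrt[p^c]{\alpha}$ be any $p^c$-th root of $\alpha$ in the algebraic closure, and let $L$ be the Galois closure of $K_d(\sqrt[p^c]{\alpha})$ over $K_0$. Then $$h_{L/K_0}\le\max\left(d-1,\ c+\ell-1-\frac{v_\ell(t_\alpha)-1}{p^{\ell-1}(p-1)},\ c+\ell-2+\frac{1}{p^{\ell-1}(p-1)}\right),$$ where the second term is read as $-\infty$, i.e. omitted, if $t_\alpha=0$. -/

import Mathlib

namespace LocalRamification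

open IsLocalRing

section DiscreteValuationRings

theorem adicComplete_of_finite (A B : Type*) [CommRing A] [IsNoetherianRing A] [IsLocalRing A]
    [IsAdicComplete (maximalIdeal A) A] [CommRing B] [Algebra A B] [Module.Finite A B] :
    IsAdicComplete ((maximalIdeal A).map (algebraMap A B)) B := by
  rw [IsAdicComplete.map_algebraMap_iff]
  have h1 := AdicCompletion.ofTensorProduct_surjective_of_finite (maximalIdeal A) B
  have h2 : Function.Bijective (AdicCompletion.of (maximalIdeal A) A) :=
    AdicCompletion.of_bijective_iff.2 ‹_›
  let e := LinearEquiv.ofBijective (AdicCompletion.of (maximalIdeal A) A) h2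
  let f : B ≃ₗ[A] TensorProduct A (AdicCompletion (maximalIdeal A) A) B :=
    (TensorProduct.lid A B).symm ≪≫ₗ TensorProduct.congr e (LinearEquiv.refl A B)
  have h3 : ⇑(AdicCompletion.of (maximalIdeal A) B) =
      AdicCompletion.ofTensorProduct (maximalIdeal A) B ∘ f := by
    ext x n
    simp only [f, e, Function.comp_apply, LinearEquiv.trans_apply, TensorProduct.lid_symm_apply,
      TensorProduct.congr_tmul, LinearEquiv.ofBijective_apply, LinearEquiv.refl_apply,
      AdicCompletion.ofTensorProduct_tmul]
    simp
    exact (one_smul A _).symm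
  have : IsPrecomplete (maximalIdeal A) B := by
    rw [← AdicCompletion.of_surjective_iff, h3]
    exact h1.comp f.surjective
  exact ⟨⟩

theorem isLocalRing_of_finite_of_isAdicComplete (A B : Type*) [CommRing A] [IsDomain A]
    [IsDiscreteValuationRing A] [IsAdicComplete (maximalIdeal A) A] [CommRing B]
    [IsDedekindDomain B] [Algebra A B] [Module.Finite A B] [FaithfulSMul A B] :
    IsLocalRing B := by
  have hc := adicComplete_of_finite A B
  set J := (maximalIdeal A).map (algebraMap A B) with hJ
  have hens : HenselianRing B J := inferInstance
  have hJ0 : J ≠ ⊥ := by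
    rw [hJ, Ne, Ideal.map_eq_bot_iff_of_injective (FaithfulSMul.algebraMap_injective A B)]
    exact IsDiscreteValuationRing.not_a_field A
  have hle : ∀ P : Ideal B, P.IsMaximal → J ≤ P := fun P hP =>
    hens.jac.trans (sInf_le ⟨bot_le, hP⟩)
  refine IsLocalRing.of_unique_max_ideal ?_
  obtain ⟨P, hP⟩ := Ideal.exists_maximal B
  refine ⟨P, hP, fun Q hQ => ?_⟩
  by_contra hne
  have hP0 : P ≠ ⊥ := fun h => hJ0 (le_bot_iff.1 (h ▸ hle P hP))
  have hfin : FiniteMultiplicity P J :=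
    FiniteMultiplicity.of_prime_left (Ideal.prime_of_isPrime hP0 hP.isPrime) hJ0
  obtain ⟨C, hJC, hC⟩ := hfin.exists_eq_pow_mul_and_not_dvd
  set n := multiplicity P J
  have hn : n ≠ 0 := by
    intro h
    rw [h, pow_zero, one_mul] at hJC
    exact hC (hJC ▸ Ideal.dvd_iff_le.2 (hle P hP))
  have hCQ : C ≤ Q := by
    have h := hle Q hQ
    rw [hJC, hQ.isPrime.mul_le] at h
    refine h.resolve_left fun h => hne ?_
    exact (hP.eq_of_le hQ.ne_top (hQ.isPrime.le_of_pow_le h)).symm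
  have hcop : IsCoprime (P ^ n) C := by
    refine IsCoprime.pow_left (Ideal.isCoprime_iff_sup_eq.2 ?_)
    by_contra h
    exact hC (Ideal.dvd_iff_le.2
      (le_sup_right.trans (hP.eq_of_le h le_sup_left).symm.le))
  obtain ⟨e, he, e', he', hee⟩ := Ideal.isCoprime_iff_exists.1 hcop
  have hm : e * e' ∈ J := hJC ▸ Ideal.mul_mem_mul he he'
  have heq : e' = 1 - e := by rw [← hee]; ring
  obtain ⟨a, ha, haJ⟩ := hens.is_henselian (Polynomial.X ^ 2 - Polynomial.X)
    (by monicity!) e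
    (by simpa [heq, pow_two, mul_sub] using J.neg_mem hm) (by
      refine IsUnit.of_mul_eq_one (Ideal.Quotient.mk J (2 * e - 1)) ?_
      rw [← map_mul, ← map_one (Ideal.Quotient.mk J), Ideal.Quotient.eq]
      convert J.mul_mem_left (-4) hm using 1
      simp [heq]
      ring)
  have heP : e ∈ P := Ideal.pow_le_self hn he
  have ha' : a = 0 ∨ a = 1 := by
    have : a * (a - 1) = 0 := by
      have := ha.eq_zero
      simp at this
      linear_combination this
    rcases mul_eq_zero.1 this with h | h
    · exact Or.inl h
    · exact Or.inr (sub_eq_zero.1 h)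
  rcases ha' with rfl | rfl
  · have h1 : e ∈ Q := by simpa using Q.neg_mem (hle Q hQ haJ)
    exact hQ.ne_top (Q.eq_top_iff_one.2 (hee ▸ Q.add_mem h1 (hCQ he')))
  · have h1 := P.add_mem (hle P hP haJ) heP
    exact hP.ne_top (P.eq_top_iff_one.2 (by simpa using h1))


theorem isDiscreteValuationRing_integralClosure (A K L : Type*) [CommRing A] [IsDomain A]
    [IsDiscreteValuationRing A] [IsAdicComplete (maximalIdeal A) A] [Field K] [Algebra A K]
    [IsFractionRing A K] [Field L] [Algebra K L] [Algebra A L] [IsScalarTower A K L]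
    [FiniteDimensional K L] [Algebra.IsSeparable K L] :
    IsDiscreteValuationRing (integralClosure A L) := by
  have := integralClosure.isDedekindDomain A K L
  have := IsIntegralClosure.finite A K L (integralClosure A L)
  have hinj : Function.Injective (algebraMap A L) := by
    rw [IsScalarTower.algebraMap_eq A K L]
    exact (algebraMap K L).injective.comp (IsFractionRing.injective A K)
  have : FaithfulSMul A (integralClosure A L) := by
    rw [faithfulSMul_iff_algebraMap_injective]
    intro x y hxy
    exact hinj (congrArg Subtype.val hxy)
  have := isLocalRing_of_finite_of_isAdicComplete A (integralClosure A L)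
  have hnf : ¬ IsField (integralClosure A L) := fun h =>
    IsDiscreteValuationRing.not_isField A
      (isField_of_isIntegral_of_isField (FaithfulSMul.algebraMap_injective A (integralClosure A L)) h)
  exact ((IsDiscreteValuationRing.TFAE (integralClosure A L) hnf).out 2 0).1 ‹IsDedekindDomain _›

end DiscreteValuationRings

section Ramification

/-! Here `K` is the fraction field of a complete discrete valuation ring `A`, and `L` is a finite
separable extension of `K`, with ring of integers `integralClosure A L`. -/

variable (A K L : Type*) [CommRing A] [IsDomain A] [IsDiscreteValuationRing A]
  [IsAdicComplete (maximalIdeal A) A] [Field K] [Algebra A K] [IsFractionRing A K]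
  [Field L] [Algebra K L] [Algebra A L] [IsScalarTower A K L]
  [FiniteDimensional K L] [Algebra.IsSeparable K L]

/-- The normalized valuation of `L` (uniformizers have valuation `1`, and `0` has valuation `⊤`),
on the ring of integers of `L`. -/
noncomputable def val : AddValuation (integralClosure A L) ℕ∞ :=
  haveI := isDiscreteValuationRing_integralClosure A K L
  IsDiscreteValuationRing.addVal (integralClosure A L)

/-- The ramification group `G_i` in the lower numbering, for real `i ≥ 0`: all `g ∈ Gal(L/K)` with
`v_L(g x - x) ≥ i + 1` for every integer `x` of `L`. -/
noncomputable def lowerGroup (i : ℝ) : Subgroup Gal(L/K) where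
  carrier := {g | ∀ x : integralClosure A L, ((⌈i⌉₊ + 1 : ℕ) : ℕ∞) ≤ val A K L (g • x - x)}
  one_mem' x := by simp
  mul_mem' {g h} hg hh x := by
    have : (g * h) • x - x = (g • (h • x) - h • x) + (h • x - x) := by
      rw [mul_smul]; abel
    rw [this]
    exact (le_min (hg _) (hh _)).trans (AddValuation.map_add _ _ _)
  inv_mem' {g} hg x := by
    have : g⁻¹ • x - x = -(g • (g⁻¹ • x) - g⁻¹ • x) := by
      rw [smul_inv_smul]; abel
    rw [this, AddValuation.map_neg]
    exact hg _

/-- The Herbrand function `φ(u) = ∫₀ᵘ dt / [G_0 : G_t]`. -/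
noncomputable def herbrandPhi (u : ℝ) : ℝ :=
  ∫ t in (0 : ℝ)..u, (((lowerGroup A K L t).relIndex (lowerGroup A K L 0) : ℕ) : ℝ)⁻¹

/-- The inverse `ψ : [0, ∞) → [0, ∞)` of the Herbrand function `φ`. -/
noncomputable def herbrandPsi : ℝ → ℝ :=
  Function.invFunOn (herbrandPhi A K L) (Set.Ici 0)

/-- The ramification group `G^i = G_{ψ(i)}` in the upper numbering, for real `i ≥ 0`. -/
noncomputable def upperGroup (i : ℝ) : Subgroup Gal(L/K) :=
  lowerGroup A K L (herbrandPsi A K L i)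

/-- The conductor `h_{L/K}`: the supremum in `[0, ∞]` of all real `i ≥ 0` with `G^i ≠ {id}`
(so it is `0` for the trivial extension). -/
noncomputable def ramConductor : ENNReal :=
  ⨆ (i : ℝ) (_ : 0 ≤ i ∧ upperGroup A K L i ≠ ⊥), ENNReal.ofReal i

end Ramification

section Witt

variable (p : ℕ) [Fact p.Prime] (k : Type*) [Field k] [CharP k p]

instance charZero_wittVector : CharZero (WittVector p k) := by
  obtain ⟨q, hq⟩ := CharP.exists (WittVector p k)
  rcases CharP.char_is_prime_or_zero (WittVector p k) q with h | rfl
  · have h1 : ((q : ℕ) : k) = 0 := by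
      rw [← map_natCast (WittVector.constantCoeff (p := p) (R := k)), CharP.cast_eq_zero, map_zero]
    rw [CharP.cast_eq_zero_iff k p, Nat.prime_dvd_prime_iff_eq Fact.out h] at h1
    exact absurd (h1 ▸ CharP.cast_eq_zero (WittVector p k) q) (WittVector.p_nonzero p k)
  · exact CharP.charP_to_charZero _

instance isAdicComplete_wittVector [PerfectRing k p] :
    IsAdicComplete (maximalIdeal (WittVector p k)) (WittVector p k) := by
  rw [(WittVector.irreducible p (k := k)).maximalIdeal_eq]
  infer_instance

/-- The field `K_0 = Frac(W(k))`. -/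
abbrev BaseField : Type _ := FractionRing (WittVector p k)

/-- An algebraic closure of `K_0`. -/
abbrev ClosedField : Type _ := AlgebraicClosure (BaseField p k)

/-- The field `K_n = K_0(ζ_{p^n})`, generated over `K_0` by the `p^n`-th roots of unity. -/
noncomputable def cyclotomicLayer (n : ℕ) : IntermediateField (BaseField p k) (ClosedField p k) :=
  IntermediateField.adjoin (BaseField p k) {z : ClosedField p k | z ^ p ^ n = 1}

/-- The field `K_d(x)`; for `x` with `x ^ p ^ c = α` this is `K_d` with a `p^c`-th root of `α`
adjoined. -/
noncomputable def kummerLayer (d : ℕ) (x : ClosedField p k) :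
    IntermediateField (BaseField p k) (ClosedField p k) :=
  cyclotomicLayer p k d ⊔ IntermediateField.adjoin (BaseField p k) {x}

/-- The Galois closure of `K_d(x)` over `K_0`. -/
noncomputable def kummerClosure (d : ℕ) (x : ClosedField p k) :
    IntermediateField (BaseField p k) (ClosedField p k) :=
  IntermediateField.normalClosure (BaseField p k) (kummerLayer p k d x) (ClosedField p k)

instance finiteDimensional_cyclotomicLayer (n : ℕ) :
    FiniteDimensional (BaseField p k) (cyclotomicLayer p k n) := by
  have hpos : 0 < p ^ n := pow_pos (Nat.Prime.pos Fact.out) n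
  have : Finite {z : ClosedField p k | z ^ p ^ n = 1} := by
    have h := (Polynomial.nthRootsFinset (p ^ n) (1 : ClosedField p k)).finite_toSet
    refine h.subset fun z hz => ?_
    simpa [Polynomial.mem_nthRootsFinset hpos] using hz
  exact IntermediateField.finiteDimensional_adjoin fun x _ => Algebra.IsIntegral.isIntegral x

instance finiteDimensional_kummerLayer (d : ℕ) (x : ClosedField p k) :
    FiniteDimensional (BaseField p k) (kummerLayer p k d x) := by
  have := IntermediateField.adjoin.finiteDimensional
    (Algebra.IsIntegral.isIntegral (R := BaseField p k) x)
  exact IntermediateField.finiteDimensional_sup _ _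

instance finiteDimensional_kummerClosure (d : ℕ) (x : ClosedField p k) :
    FiniteDimensional (BaseField p k) (kummerClosure p k d x) :=
  normalClosure.is_finiteDimensional (BaseField p k) (kummerLayer p k d x) (ClosedField p k)

end Witt

end LocalRamification

/-! Let `π` be a uniformizer of `L`, `n = [L : K₀]`, `e = v_L(p)` and `j(h) = v_L(hπ - π)`. The
residue field is algebraically closed, so `O_L = W(k)[π]`. Suppose `G^i ≠ 1`; let `I` be the maximum
of `j` on nontrivial elements, attained at `g`, and let `N = I + ∑_{h ≠ 1} j(h)`. The explicit form
of `φ` gives `n (i + 1) ≤ N` (`exists_approxRelations_of_upperGroup_ne_bot`). A polynomial over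
`W(k)` vanishing at `π` is divisible by `∏ (X - hπ)`, so it has valuation at least `N` on the whole
ball `π + π^I O_L`, which contains `gπ`.

Write `b = P(π)`. The values `P(π + π^I z)` form a polynomial family that starts at `b` and nearly
satisfies every equation of `b`. If `N` is large compared with the distances between the roots of
such an equation, the family cannot leave the neighbourhood of `b`: at a generic `z` it would be far
from all roots (`approx_root_of_le_addVal_prod`). Since `gb` is a member of the family, it is then
closer to `b` than any other root is; being itself a root, it equals `b`.

For `ζ_{p^d}` this needs `N > d e`, which holds for `i > d - 1` because `e ≤ n`. For the radical,
put `λ = ζ_{p^ℓ} - 1` and write `α = λ^a U(λ)` with `U` over `W(k)`. The cyclotomic case bounds the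
error in `λ`, hence that in `α`, the more so if `α = 1 + λ^m V(λ)`; this yields the second term of
the maximum. The third makes the relation for the radical itself precise enough. So if `i` exceeds
all three terms, `g` fixes `ζ_{p^d}` and all conjugates of the radical
(`exists_fixing_automorphism`). These generate `L`, so `g = 1`, a contradiction. -/

namespace LocalRamification

open IsLocalRing Polynomial

/-! ### Approximate roots over a discrete valuation ring. -/

section Valuations

variable {R : Type*} [CommRing R] [IsDomain R] [IsDiscreteValuationRing R]

local notation "v" => IsDiscreteValuationRing.addVal R

theorem addVal_prod {ι : Type*} (s : Finset ι) (f : ι → R) :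
    v (∏ i ∈ s, f i) = ∑ i ∈ s, v (f i) := by
  classical
  induction s using Finset.induction_on with
  | empty => simp
  | insert a s ha ih => rw [Finset.prod_insert ha, Finset.sum_insert ha, AddValuation.map_mul, ih]

theorem addVal_sub_eq_of_lt {x y z : R} (h : v (y - z) < v (x - y)) :
    v (x - z) = v (y - z) := by
  have : x - z = (x - y) + (y - z) := by ring
  rw [this, add_comm, AddValuation.map_add_eq_of_lt_left _ h]

theorem pow_dvd_iff_le_addVal {π : R} (hπ : Irreducible π) (n : ℕ) (x : R) :
    π ^ n ∣ x ↔ (n : ℕ∞) ≤ v x := by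
  rw [← IsDiscreteValuationRing.addVal_le_iff_dvd, hπ.addVal_pow]

theorem le_addVal_sub {x y : R} {n : ℕ∞} (hx : n ≤ v x) (hy : n ≤ v y) : n ≤ v (x - y) :=
  (le_min hx hy).trans (AddValuation.map_sub _ _ _)

theorem le_addVal_add {x y : R} {n : ℕ∞} (hx : n ≤ v x) (hy : n ≤ v y) : n ≤ v (x + y) :=
  (le_min hx hy).trans (AddValuation.map_add _ _ _)

/-- A nonzero polynomial over a discrete valuation ring is a constant times a polynomial with
nonzero reduction; the constant divides all coefficients. -/
theorem exists_eq_C_mul_map_residue_ne_zero {Q : R[X]} (hQ : Q ≠ 0) :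
    ∃ (a : R) (Q' : R[X]), Q = C a * Q' ∧ (∀ k, a ∣ Q.coeff k) ∧ Q'.map (residue R) ≠ 0 := by
  obtain ⟨m, hm, hmin⟩ := Q.support.exists_min_image (fun k => v (Q.coeff k))
    (Polynomial.support_nonempty.2 hQ)
  have hdvd : ∀ k, Q.coeff m ∣ Q.coeff k := fun k => by
    by_cases hk : k ∈ Q.support
    · exact IsDiscreteValuationRing.addVal_le_iff_dvd.1 (hmin k hk)
    · rw [Polynomial.notMem_support_iff.1 hk]; exact dvd_zero _
  obtain ⟨Q', hQ'⟩ := (C_dvd_iff_dvd_coeff _ _).2 hdvd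
  refine ⟨_, Q', hQ', hdvd, fun h => ?_⟩
  have h1 : Q.coeff m * Q'.coeff m = Q.coeff m * 1 := by
    rw [← coeff_C_mul, ← hQ', mul_one]
  have h2 := mul_left_cancel₀ (Polynomial.mem_support_iff.1 hm) h1
  have h3 := congrArg (fun q => q.coeff m) h
  simp [h2] at h3

/-- At a generic point of the ring, the value of a polynomial divides all its coefficients. -/
theorem exists_eval_dvd_coeff [Infinite (ResidueField R)] {ι : Type*} (s : Finset ι)
    (Q : ι → R[X]) (hQ : ∀ j ∈ s, Q j ≠ 0) :
    ∃ z : R, ∀ j ∈ s, ∀ k, (Q j).eval z ∣ (Q j).coeff k := by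
  have h := fun j : s => exists_eq_C_mul_map_residue_ne_zero (hQ j j.2)
  choose a Q' hQ' hdvd hne using h
  -- Generic means avoiding the finitely many zeros of this reduction; at a lift of such a residue
  -- each `Q' j` takes a unit value.
  have hP : ∏ j, (Q' j).map (residue R) ≠ 0 := Finset.prod_ne_zero_iff.2 fun j _ => hne j
  obtain ⟨y, hy⟩ : ∃ y, (∏ j, (Q' j).map (residue R)).eval y ≠ 0 := by
    by_contra! h
    exact hP (Polynomial.funext fun r => by rw [h r, eval_zero])
  obtain ⟨z, rfl⟩ := residue_surjective y
  refine ⟨z, fun j hj k => ?_⟩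
  rw [eval_prod, Finset.prod_ne_zero_iff] at hy
  have h1 := hy ⟨j, hj⟩ (Finset.mem_univ _)
  rw [eval_map, eval₂_hom, residue_ne_zero_iff_isUnit] at h1
  rw [hQ' ⟨j, hj⟩, eval_mul, eval_C, h1.mul_right_dvd, ← hQ' ⟨j, hj⟩]
  exact hdvd ⟨j, hj⟩ k

/-- A polynomial family `P` of approximate roots of `∏ (X - r)` which starts at the root `x₀` stays
closer to `x₀` than any other root, and so approximates `x₀` well. -/
theorem approx_root_of_le_addVal_prod [DecidableEq R] [Infinite (ResidueField R)] (s : Finset R) {x₀ : R}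
    (hx₀ : x₀ ∈ s) (P : R[X]) (hP : P.eval 0 = x₀) (D S M : ℕ)
    (hD : ∀ r ∈ s, r ≠ x₀ → v (x₀ - r) ≤ D) (hS : ∑ r ∈ s.erase x₀, v (x₀ - r) ≤ S)
    (hM : S + D < M) (h : ∀ z, (M : ℕ∞) ≤ v (∏ r ∈ s, (P.eval z - r))) (z : R) :
    D < v (P.eval z - x₀) ∧ M ≤ S + v (P.eval z - x₀) := by
  have hsplit : ∀ z, v (∏ r ∈ s, (P.eval z - r)) =
      (∑ r ∈ s.erase x₀, v (P.eval z - r)) + v (P.eval z - x₀) := fun z => by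
    rw [addVal_prod, Finset.sum_erase_add _ _ hx₀]
  have hcoef : ∀ r, (P - C r).coeff 0 = x₀ - r := fun r => by
    rw [coeff_sub, coeff_C_zero, coeff_zero_eq_eval_zero, hP]
  have hne : ∀ r ∈ s, r ≠ x₀ → P - C r ≠ 0 := fun r _ hr h0 => by
    have := hcoef r
    rw [h0, coeff_zero] at this
    exact hr (sub_eq_zero.1 this.symm).symm
  -- If some coefficient of `P - x₀` had valuation at most `D`, then at a generic `z` the factor at
  -- `x₀` would have valuation at most `D`, and each other factor at most that of its constant
  -- coefficient `x₀ - r`. The product would have valuation at most `S + D < M`.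
  have hclose : ∀ z, (D : ℕ∞) < v (P.eval z - x₀) := by
    by_cases hconst : P - C x₀ = 0
    · intro z
      have h0 : P.eval z - x₀ = 0 := by simpa using congrArg (eval z) hconst
      rw [h0, AddValuation.map_zero]
      exact ENat.natCast_lt_top D
    by_cases hall : ∀ k, (D : ℕ∞) < v ((P - C x₀).coeff k)
    · intro z
      obtain ⟨π, hπ⟩ := IsDiscreteValuationRing.exists_irreducible R
      have h1 : C (π ^ (D + 1)) ∣ P - C x₀ := by
        rw [C_dvd_iff_dvd_coeff]
        intro k
        rw [pow_dvd_iff_le_addVal hπ]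
        exact_mod_cast Order.add_one_le_of_lt (hall k)
      have h2 := eval_dvd (x := z) h1
      simp only [eval_C, eval_sub] at h2
      rw [pow_dvd_iff_le_addVal hπ] at h2
      refine lt_of_lt_of_le ?_ h2
      exact_mod_cast Nat.lt_succ_self D
    push Not at hall
    obtain ⟨k, hk⟩ := hall
    obtain ⟨z, hz⟩ := exists_eval_dvd_coeff s (fun r => P - C r) fun r hr => by
      by_cases h1 : r = x₀
      · rwa [h1]
      · exact hne r hr h1
    exfalso
    have h1 : v (P.eval z - x₀) ≤ D := by
      refine le_trans ?_ hk
      rw [IsDiscreteValuationRing.addVal_le_iff_dvd]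
      simpa using hz x₀ hx₀ k
    have h2 : ∑ r ∈ s.erase x₀, v (P.eval z - r) ≤ S := by
      refine (Finset.sum_le_sum fun r hr => ?_).trans hS
      rw [IsDiscreteValuationRing.addVal_le_iff_dvd]
      have := hz r (Finset.mem_of_mem_erase hr) 0
      rw [hcoef] at this
      simpa using this
    have h3 := h z
    rw [hsplit] at h3
    have h4 := h3.trans (add_le_add h2 h1)
    have : M ≤ S + D := by exact_mod_cast h4
    omega
  refine ⟨hclose z, (h z).trans ?_⟩
  rw [hsplit]
  gcongr
  refine le_trans (Finset.sum_le_sum fun r hr => ?_) hS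
  rw [Finset.mem_erase] at hr
  exact (addVal_sub_eq_of_lt ((hD r hr.2 hr.1).trans_lt (hclose z))).le

end Valuations

/-! ### Distances between `p`-power roots of unity and between radicals. -/

section RootsOfUnity

variable {R : Type*} [CommRing R] [IsDomain R] [IsDiscreteValuationRing R] {p : ℕ} [Fact p.Prime]

local notation "v" => IsDiscreteValuationRing.addVal R

theorem addVal_one_sub_eq_of_isPrimitiveRoot {n : ℕ} {ζ ξ : R} (hn : n ≠ 0)
    (hζ : IsPrimitiveRoot ζ n) (hξ : IsPrimitiveRoot ξ n) : v (ζ - 1) = v (ξ - 1) := by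
  have : NeZero n := ⟨hn⟩
  obtain ⟨i, -, hi, rfl⟩ := hζ.isPrimitiveRoot_iff.1 hξ
  exact (IsDiscreteValuationRing.addVal_eq_iff_associated _ _).2
    (hζ.associated_sub_one_pow_sub_one_of_coprime hi)

/-- The cyclotomic polynomial takes the value `p` at `1`, and the factors `1 - ξ` of this value are
all associated. -/
theorem addVal_sub_one_of_isPrimitiveRoot_prime_pow {n : ℕ} {ζ : R}
    (hζ : IsPrimitiveRoot ζ (p ^ (n + 1))) :
    ((p ^ n * (p - 1) : ℕ) : ℕ∞) * v (ζ - 1) = v (p : R) := by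
  have hp : p.Prime := Fact.out
  have h := congrArg (eval 1) (cyclotomic_eq_prod_X_sub_primitiveRoots hζ)
  rw [eval_one_cyclotomic_prime_pow, eval_prod] at h
  rw [h, addVal_prod]
  rw [Finset.sum_congr rfl (g := fun _ => v (ζ - 1)) fun ξ hξ => ?_]
  · rw [Finset.sum_const, hζ.card_primitiveRoots, Nat.totient_prime_pow_succ hp, nsmul_eq_mul]
  · have hpos := pow_pos hp.pos (n + 1)
    rw [mem_primitiveRoots hpos] at hξ
    rw [addVal_one_sub_eq_of_isPrimitiveRoot hpos.ne' hζ hξ]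
    simp only [eval_sub, eval_X, eval_C]
    rw [← AddValuation.map_neg, neg_sub]

/-- For `ξ` of order `p ^ (k + 1)` the valuation is `δ / p ^ k`, so roots of order `p` come closest
to `1`. -/
theorem addVal_sub_one_of_pow_prime_pow_eq_one {n e δ : ℕ} {ξ : R} (he : v (p : R) = e)
    (hδ : (p - 1) * δ = e) (hξ : ξ ^ p ^ n = 1) (hξ1 : ξ ≠ 1) : v (ξ - 1) ≤ δ := by
  have hp : p.Prime := Fact.out
  obtain ⟨k, hk, hord⟩ := (Nat.dvd_prime_pow hp).1 (orderOf_dvd_of_pow_eq_one hξ)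
  obtain ⟨k, rfl⟩ : ∃ j, k = j + 1 := Nat.exists_eq_succ_of_ne_zero fun h => hξ1 <| by
    rw [h, pow_zero, orderOf_eq_one_iff] at hord
    exact hord
  have h := addVal_sub_one_of_isPrimitiveRoot_prime_pow (hord ▸ IsPrimitiveRoot.orderOf ξ)
  obtain ⟨a, ha⟩ := ENat.ne_top_iff_exists.1 fun h : v (ξ - 1) = ⊤ =>
    hξ1 (sub_eq_zero.1 (IsDiscreteValuationRing.addVal_eq_top_iff.1 h))
  rw [he, ← ha, ← hδ] at h
  rw [← ha]
  have h2 : p ^ k * (p - 1) * a = (p - 1) * δ := by exact_mod_cast h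
  have h3 : p ^ k * a = δ := Nat.eq_of_mul_eq_mul_left (Nat.sub_pos_of_lt hp.one_lt) (by linarith)
  have h4 : a ≤ δ := h3 ▸ Nat.le_mul_of_pos_left a (pow_pos hp.pos k)
  exact_mod_cast h4

theorem addVal_sub_one_of_isPrimitiveRoot_prime {e δ : ℕ} {ξ : R} (he : v (p : R) = e)
    (hδ : (p - 1) * δ = e) (hξ : IsPrimitiveRoot ξ p) : v (ξ - 1) = δ := by
  have hp : p.Prime := Fact.out
  have h := addVal_sub_one_of_isPrimitiveRoot_prime_pow (n := 0) (p := p) (ζ := ξ) (by simpa)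
  obtain ⟨a, ha⟩ := ENat.ne_top_iff_exists.1 fun h : v (ξ - 1) = ⊤ =>
    hξ.ne_one hp.one_lt (sub_eq_zero.1 (IsDiscreteValuationRing.addVal_eq_top_iff.1 h))
  rw [he, ← ha, ← hδ] at h
  rw [← ha]
  have h2 : (p - 1) * a = (p - 1) * δ := by simpa using (by exact_mod_cast h :
    p ^ 0 * (p - 1) * a = (p - 1) * δ)
  exact_mod_cast Nat.eq_of_mul_eq_mul_left (Nat.sub_pos_of_lt hp.one_lt) h2

/-- The quotient of the two roots is a nontrivial root of unity. This bound is the separation `D` in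
both applications of `approx_root_of_le_addVal_prod`. -/
theorem addVal_sub_le_of_pow_eq_pow {n e δ : ℕ} {x y : R} (he : v (p : R) = e)
    (hδ : (p - 1) * δ = e) {η : R} (hη : IsPrimitiveRoot η (p ^ n))
    (hxy : y ^ p ^ n = x ^ p ^ n) (hne : y ≠ x) :
    v (y - x) ≤ v x + δ := by
  have hp : p.Prime := Fact.out
  have h0 : eval y (X ^ p ^ n - C (x ^ p ^ n)) = 0 := by simp [hxy]
  rw [X_pow_sub_C_eq_prod hη (pow_pos hp.pos n) rfl, eval_prod, Finset.prod_eq_zero_iff] at h0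
  obtain ⟨i, -, hi⟩ := h0
  have hi' : y = η ^ i * x := by simpa [sub_eq_zero] using hi
  subst hi'
  have : η ^ i * x - x = (η ^ i - 1) * x := by ring
  rw [this, AddValuation.map_mul, add_comm]
  gcongr
  refine addVal_sub_one_of_pow_prime_pow_eq_one (n := n) he hδ ?_ ?_
  · rw [← pow_mul, mul_comm, pow_mul, hη.pow_eq_one, one_pow]
  · intro h; exact hne (by rw [h, one_mul])

theorem eval_derivative_prod_X_sub_C {A : Type*} [CommRing A] [DecidableEq A] {s : Finset A}
    {x : A} (hx : x ∈ s) :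
    (derivative (∏ r ∈ s, (X - C r))).eval x = ∏ r ∈ s.erase x, (x - r) := by
  rw [← Finset.mul_prod_erase s _ hx, derivative_mul]
  simp [eval_prod]

end RootsOfUnity

/-! ### Polynomial values on a ball around the uniformizer. -/

section Deformation

variable {W R : Type*} [CommRing W] [CommRing R] [Algebra W R] {p : ℕ} [Fact p.Prime] {π : R}
  {I N : ℕ}

local notation "v" => IsDiscreteValuationRing.addVal R

/-- The family of values of `P` at the points `π + π ^ I z`, as a polynomial in `z`. -/
noncomputable def deform (π : R) (I : ℕ) (P : W[X]) : R[X] :=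
  (P.map (algebraMap W R)).comp (C π + C (π ^ I) * X)

theorem eval_deform (P : W[X]) (z : R) :
    (deform π I P).eval z = aeval (π + π ^ I * z) P := by
  simp [deform, eval_comp, eval_map_algebraMap]

/-- If `π + π ^ I z` is the image of `π` under an automorphism, then the value of `P` there is the
image of `P(π)`. -/
theorem apply_eq_aeval {P : W[X]} {b : R} (hP : aeval π P = b) (g : R →ₐ[W] R) {z : R}
    (hz : g π = π + π ^ I * z) : g b = aeval (π + π ^ I * z) P := by
  rw [← hP, ← hz, aeval_algHom_apply]

variable [IsDomain R] [IsDiscreteValuationRing R]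

variable (π I N) in
/-- Relations over `W` satisfied by `π` hold up to valuation `N` at all points `π + π ^ I z`. -/
def ApproxRelations (W : Type*) [CommRing W] [Algebra W R] : Prop :=
  ∀ P : W[X], aeval π P = 0 → ∀ z : R, (N : ℕ∞) ≤ v (aeval (π + π ^ I * z) P)

/-- This is `approx_root_of_le_addVal_prod` for the cyclotomic polynomial, with separation `δ` and
distance sum `(l + 1) e - δ`. The second conclusion is the quantitative error used later for
radicals. -/
theorem deform_isPrimitiveRoot [Infinite (ResidueField R)]
    (hN : ApproxRelations π I N W) {l e δ : ℕ} {ζ : R} (hζ : IsPrimitiveRoot ζ (p ^ (l + 1)))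
    {P : W[X]} (hP : aeval π P = ζ) (he : v (p : R) = e) (hδ : (p - 1) * δ = e)
    (hlN : (l + 1) * e < N) (z : R) :
    δ < v (aeval (π + π ^ I * z) P - ζ) ∧
      (N + δ : ℕ) ≤ ((l + 1) * e : ℕ) + v (aeval (π + π ^ I * z) P - ζ) := by
  classical
  have hp : p.Prime := Fact.out
  have hpos := pow_pos hp.pos (l + 1)
  set s := primitiveRoots (p ^ (l + 1)) R
  have hζs : ζ ∈ s := (mem_primitiveRoots hpos).2 hζ
  have hcyc : cyclotomic (p ^ (l + 1)) R = ∏ r ∈ s, (X - C r) :=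
    cyclotomic_eq_prod_X_sub_primitiveRoots hζ
  have hζu : IsUnit ζ := hζ.isUnit hpos.ne'
  -- The sum is the valuation of `Φ'(ζ)`. Differentiating `Φ * (X ^ p ^ l - 1) = X ^ p ^ (l + 1) -
  -- 1` at `ζ` gives `Φ'(ζ) (ζ ^ p ^ l - 1) = p ^ (l + 1) * unit`, and `ζ ^ p ^ l` has order `p`.
  have hS : ∑ r ∈ s.erase ζ, v (ζ - r) + δ = ((l + 1) * e : ℕ) := by
    rw [← addVal_prod, ← eval_derivative_prod_X_sub_C hζs, ← hcyc]
    have h1 := congrArg (fun q => (derivative q).eval ζ) (cyclotomic_prime_pow_mul_X_pow_sub_one R p l)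
    have h2 : eval ζ (cyclotomic (p ^ (l + 1)) R) = 0 := hζ.isRoot_cyclotomic hpos
    simp only [derivative_mul, eval_add, eval_mul, h2, zero_mul, add_zero, derivative_sub,
      derivative_X_pow, derivative_one, sub_zero, eval_sub, eval_pow, eval_X, eval_one,
      eval_natCast, map_natCast] at h1
    have h3 : IsPrimitiveRoot (ζ ^ p ^ l) p := hζ.pow hpos (pow_succ _ _)
    rw [← addVal_sub_one_of_isPrimitiveRoot_prime he hδ h3, ← AddValuation.map_mul, h1,
      AddValuation.map_mul, Nat.cast_pow, AddValuation.map_pow, he,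
      IsDiscreteValuationRing.addVal_eq_zero_iff.2 (hζu.pow _)]
    simp
  have hS' : ∑ r ∈ s.erase ζ, v (ζ - r) = ((l + 1) * e - δ : ℕ) := by
    have htop : ∑ r ∈ s.erase ζ, v (ζ - r) ≠ ⊤ := fun h => by
      rw [h, top_add] at hS
      exact ENat.natCast_ne_top _ hS.symm
    lift ∑ r ∈ s.erase ζ, v (ζ - r) to ℕ using htop with a
    norm_cast at hS ⊢
    omega
  have hle : δ ≤ (l + 1) * e := by exact_mod_cast hS ▸ le_add_self
  have h := approx_root_of_le_addVal_prod s hζs (deform π I P) (by simp [eval_deform, hP])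
    δ ((l + 1) * e - δ) N ?_ hS'.le (by omega) ?_ z
  · rw [eval_deform] at h
    refine ⟨h.1, ?_⟩
    have h1 := add_le_add_left h.2 (δ : ℕ∞)
    rw [add_right_comm] at h1
    rw [← Nat.cast_add, ← Nat.cast_add, Nat.sub_add_cancel hle] at h1
    exact h1
  · intro r hr hne
    have hr' := (mem_primitiveRoots hpos).1 hr
    have := addVal_sub_le_of_pow_eq_pow he hδ hζ (hζ.pow_eq_one.trans hr'.pow_eq_one.symm) hne.symm
    rwa [IsDiscreteValuationRing.addVal_eq_zero_iff.2 (hr'.isUnit hpos.ne'), zero_add] at this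
  · intro z
    have h1 : aeval π (((cyclotomic (p ^ (l + 1)) W).comp P)) = 0 := by
      rw [aeval_comp, hP, aeval_def, ← eval_map, map_cyclotomic]
      exact hζ.isRoot_cyclotomic hpos
    have h2 := hN _ h1 z
    rw [aeval_comp, aeval_def, ← eval_map, map_cyclotomic, hcyc, eval_prod] at h2
    simpa [eval_deform] using h2

theorem apply_isPrimitiveRoot_eq [Infinite (ResidueField R)]
    (hgen : ∀ b : R, ∃ P : W[X], aeval π P = b) (hN : ApproxRelations π I N W)
    {l e δ : ℕ} {ζ : R} (hζ : IsPrimitiveRoot ζ (p ^ (l + 1)))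
    (he : v (p : R) = e) (hδ : (p - 1) * δ = e)
    (hlN : (l + 1) * e < N) (g : R →ₐ[W] R) {z : R} (hz : g π = π + π ^ I * z) : g ζ = ζ := by
  have hpos := pow_pos (Fact.out : p.Prime).pos (l + 1)
  obtain ⟨P, hP⟩ := hgen ζ
  have h := (deform_isPrimitiveRoot hN hζ hP he hδ hlN z).1
  rw [← apply_eq_aeval hP g hz] at h
  by_contra hne
  have := addVal_sub_le_of_pow_eq_pow he hδ hζ (y := g ζ)
    (by rw [← map_pow, hζ.pow_eq_one, map_one]) hne
  rw [IsDiscreteValuationRing.addVal_eq_zero_iff.2 (hζ.isUnit hpos.ne'), zero_add] at this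
  exact absurd h this.not_gt

/-- The function `λ ^ a U(λ)` varies by at least `(a + m - 1) q + T` on the set of `λ` of valuation
at least `q`, when `λ` varies by `T`. -/
def VariationBound (R : Type*) [CommRing R] [IsDomain R] [IsDiscreteValuationRing R]
    [Algebra W R] (a m : ℕ) (U : W[X]) : Prop :=
  ∀ (x y : R) (q T : ℕ), q ≤ IsDiscreteValuationRing.addVal R x →
    q ≤ IsDiscreteValuationRing.addVal R y → T ≤ IsDiscreteValuationRing.addVal R (y - x) →
    (a * q + T + m * q : ℕ) ≤
      IsDiscreteValuationRing.addVal R (y ^ a * aeval y U - x ^ a * aeval x U) + q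

/-- Factor `y ^ a - x ^ a` as `y - x` times a geometric sum whose terms have degree `a - 1`. The
extra `q` on the right avoids the subtraction in `(a - 1) q`. -/
theorem le_addVal_pow_sub_pow {x y : R} {q T : ℕ} (hx : q ≤ v x) (hy : q ≤ v y)
    (hxy : T ≤ v (y - x)) (a : ℕ) : (a * q + T : ℕ) ≤ v (y ^ a - x ^ a) + q := by
  obtain ⟨ϖ, hϖ⟩ := IsDiscreteValuationRing.exists_irreducible R
  have hpow : ∀ (w : R) (n : ℕ), q ≤ v w → ϖ ^ (q * n) ∣ w ^ n := fun w n hw => by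
    rw [pow_mul]; exact pow_dvd_pow_of_dvd ((pow_dvd_iff_le_addVal hϖ _ _).2 hw) n
  rcases a with _ | a
  · simp
  have h1 : ϖ ^ (q * a) ∣ ∑ i ∈ Finset.range (a + 1), y ^ i * x ^ (a - i) := by
    refine Finset.dvd_sum fun i hi => ?_
    have : q * a = q * i + q * (a - i) := by
      rw [← mul_add, Nat.add_sub_cancel' (Nat.lt_succ_iff.1 (Finset.mem_range.1 hi))]
    rw [this, pow_add]
    exact mul_dvd_mul (hpow _ _ hy) (hpow _ _ hx)
  have h2 : ϖ ^ (q * a + T) ∣ y ^ (a + 1) - x ^ (a + 1) := by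
    have := (Commute.all y x).geom_sum₂_mul (a + 1)
    rw [← this, pow_add]
    exact mul_dvd_mul (by simpa using h1) ((pow_dvd_iff_le_addVal hϖ _ _).2 hxy)
  rw [pow_dvd_iff_le_addVal hϖ] at h2
  have h3 := add_le_add_left h2 (q : ℕ∞)
  have h4 : (a + 1) * q + T = q * a + T + q := by ring
  rwa [h4, Nat.cast_add]

theorem le_addVal_aeval_sub_aeval {x y : R} {T : ℕ∞} (hxy : T ≤ v (y - x)) (U : W[X]) :
    T ≤ v (aeval y U - aeval x U) :=
  hxy.trans (IsDiscreteValuationRing.addVal_le_iff_dvd.2 (by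
    simpa [eval_map_algebraMap] using sub_dvd_eval_sub y x (U.map (algebraMap W R))))

theorem le_addVal_pow_mul {x : R} {q : ℕ} (hx : q ≤ v x) (a : ℕ) (y : R) :
    (a * q : ℕ) ≤ v (x ^ a * y) := by
  rw [AddValuation.map_mul, AddValuation.map_pow, nsmul_eq_mul, Nat.cast_mul]
  exact (mul_le_mul_right hx _).trans le_self_add

theorem le_addVal_pow_mul_aeval_sub (a : ℕ) (U : W[X]) {x y : R} {q T : ℕ} (hx : q ≤ v x)
    (hy : q ≤ v y) (hxy : T ≤ v (y - x)) :
    (a * q + T : ℕ) ≤ v (y ^ a * aeval y U - x ^ a * aeval x U) + q := by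
  have h1 : y ^ a * aeval y U - x ^ a * aeval x U =
      (y ^ a - x ^ a) * aeval y U + x ^ a * (aeval y U - aeval x U) := by ring
  have h2 : (a * q + T : ℕ) ≤ v ((y ^ a - x ^ a) * aeval y U) + q := by
    rw [AddValuation.map_mul, add_right_comm]
    exact (le_addVal_pow_sub_pow hx hy hxy a).trans le_self_add
  have h3 : (a * q + T : ℕ) ≤ v (x ^ a * (aeval y U - aeval x U)) + q := by
    have h4 := le_addVal_pow_mul hx a 1
    rw [mul_one] at h4
    rw [AddValuation.map_mul, Nat.cast_add]
    exact (add_le_add h4 (le_addVal_aeval_sub_aeval hxy U)).trans le_self_add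
  rw [h1]
  refine le_trans ?_ (add_le_add_left (AddValuation.map_add _ _ _) _)
  rcases min_choice (v ((y ^ a - x ^ a) * aeval y U)) (v (x ^ a * (aeval y U - aeval x U)))
    with h | h <;> rw [h] <;> assumption

theorem variationBound_zero (a : ℕ) (U : W[X]) : VariationBound R a 0 U := by
  intro x y q T hx hy hxy
  simpa using le_addVal_pow_mul_aeval_sub a U hx hy hxy

/-- The constant `1` cancels in the difference, so `X ^ m * V` varies just as a function with
leading power `m` does. -/
theorem variationBound_one_add (m : ℕ) (V : W[X]) : VariationBound R 0 m (1 + X ^ m * V) := by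
  intro x y q T hx hy hxy
  have := le_addVal_pow_mul_aeval_sub m V hx hy hxy
  simpa [add_comm] using this

end Deformation

/-! ### Rigidity of radicals. -/

section Kummer

variable {W R : Type*} [CommRing W] [CommRing R] [Algebra W R] {p : ℕ} [Fact p.Prime] {π : R}
  {I N : ℕ} [IsDomain R] [IsDiscreteValuationRing R]

local notation "v" => IsDiscreteValuationRing.addVal R

/-- The equation of `x` involves `λ = ζ - 1`, which moves along the ball too. The deviation of the
deformed `x ^ p ^ c` is split into the failure of the relation between `x` and `λ` (controlled by
`h2`) and the variation of `λ ^ a U(λ)` (controlled by `h3`). -/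
theorem exists_deform_radical [Infinite (ResidueField R)] (hπ : Irreducible π) (hI : 1 ≤ I)
    (hgen : ∀ b : R, ∃ P : W[X], aeval π P = b) (hN : ApproxRelations π I N W)
    {l c e δ q a m : ℕ} {ζ η x : R} (hζ : IsPrimitiveRoot ζ (p ^ (l + 1)))
    (hη : IsPrimitiveRoot η (p ^ c)) (hx0 : x ≠ 0) {U : W[X]} (hU : IsUnit (aeval (ζ - 1) U))
    (hx : x ^ p ^ c = (ζ - 1) ^ a * aeval (ζ - 1) U) (hvar : VariationBound R a m U)
    (he : v (p : R) = e) (hδ : (p - 1) * δ = e) (hq : v (ζ - 1) = q) (h1 : (l + 1) * e < N)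
    (h2 : c * e + δ < N) (h3 : (l + 1) * e + c * e + q < N + m * q) :
    ∃ P : W[X], aeval π P = x ∧ ∀ z, v x + δ < v (aeval (π + π ^ I * z) P - x) := by
  classical
  have hp : p.Prime := Fact.out
  have hpos := pow_pos hp.pos c
  have hlam0 : ζ - 1 ≠ 0 := fun h => by
    rw [h, AddValuation.map_zero] at hq
    exact ENat.natCast_ne_top q hq.symm
  obtain ⟨w, ε, hε⟩ := IsDiscreteValuationRing.eq_unit_mul_pow_irreducible hx0 hπ
  obtain ⟨q', μ, hμ⟩ := IsDiscreteValuationRing.eq_unit_mul_pow_irreducible hlam0 hπ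
  have hw : v x = w := by rw [hε, IsDiscreteValuationRing.addVal_def' _ hπ]
  obtain rfl : q' = q := by
    have := IsDiscreteValuationRing.addVal_def' μ hπ q'
    rw [← hμ, hq] at this
    exact_mod_cast this.symm
  have hwq : w * p ^ c = a * q' := by
    have := congrArg v hx
    rw [AddValuation.map_mul, AddValuation.map_pow, AddValuation.map_pow, hw, hq,
      IsDiscreteValuationRing.addVal_eq_zero_iff.2 hU, add_zero, nsmul_eq_mul, nsmul_eq_mul] at this
    rw [mul_comm]
    exact_mod_cast this
  obtain ⟨Pε, hPε⟩ := hgen ε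
  obtain ⟨Pμ, hPμ⟩ := hgen μ
  have hPlam : aeval π (X ^ q' * Pμ) = ζ - 1 := by
    rw [map_mul, map_pow, aeval_X, hPμ, hμ, mul_comm]
  have hPx : aeval π (X ^ w * Pε) = x := by
    rw [map_mul, map_pow, aeval_X, hPε, hε, mul_comm]
  -- Dividing by the common power `π ^ (a q')` leaves a relation between units. Multiplying back
  -- after deformation gains `a q'` on top of the precision `N`.
  have hrel : aeval π (Pε ^ p ^ c - Pμ ^ a * U.comp (X ^ q' * Pμ)) = 0 := by
    rw [map_sub, map_mul, map_pow, map_pow, hPε, hPμ, aeval_comp, hPlam]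
    refine (mul_eq_zero.1 ?_).resolve_left (pow_ne_zero (a * q') hπ.ne_zero)
    have e1 : x ^ p ^ c = π ^ (a * q') * (ε : R) ^ p ^ c := by
      conv_lhs => rw [hε]
      rw [mul_pow, ← pow_mul, hwq, mul_comm]
    have e2 : (ζ - 1) ^ a = π ^ (a * q') * (μ : R) ^ a := by
      rw [hμ, mul_pow, ← pow_mul, mul_comm q' a, mul_comm]
    rw [e1, e2] at hx
    linear_combination hx
  have hqδ : q' ≤ δ := by
    have := addVal_sub_one_of_pow_prime_pow_eq_one he hδ hζ.pow_eq_one fun h => hlam0 (by rw [h, sub_self])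
    rw [hq] at this
    exact_mod_cast this
  refine ⟨X ^ w * Pε, hPx, fun z => ?_⟩
  have hmain : ∀ z : R, ((a * q' + c * e + δ + 1 : ℕ) : ℕ∞) ≤
      v (aeval (π + π ^ I * z) (X ^ w * Pε) ^ p ^ c - x ^ p ^ c) := by
    intro z
    have hd := deform_isPrimitiveRoot hN hζ (P := X ^ q' * Pμ + 1)
      (by rw [map_add, hPlam, map_one, sub_add_cancel]) he hδ h1 z
    have hrelz := hN _ hrel z
    set y := π + π ^ I * z
    have hy : ((1 : ℕ) : ℕ∞) ≤ v y := by
      rw [← pow_dvd_iff_le_addVal hπ, pow_one]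
      exact dvd_add dvd_rfl (dvd_mul_of_dvd_left (dvd_pow_self _ (by omega)) _)
    set lam' := aeval y (X ^ q' * Pμ) with hlam'
    have hsub : aeval y (X ^ q' * Pμ + 1) - ζ = lam' - (ζ - 1) := by
      rw [map_add, map_one, ← hlam']; ring
    rw [hsub] at hd
    have hE1 : ((a * q' + c * e + δ + 1 : ℕ) : ℕ∞) ≤
        v (aeval y (X ^ w * Pε) ^ p ^ c - lam' ^ a * aeval lam' U) := by
      have e1 : aeval y (X ^ w * Pε) ^ p ^ c - lam' ^ a * aeval lam' U =
          y ^ (a * q') * aeval y (Pε ^ p ^ c - Pμ ^ a * U.comp (X ^ q' * Pμ)) := by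
        rw [map_sub, map_mul, map_mul, map_pow, map_pow, map_pow, aeval_comp, ← hlam', aeval_X,
          mul_pow, ← pow_mul, hwq]
        have : lam' ^ a = y ^ (a * q') * aeval y Pμ ^ a := by
          rw [hlam', map_mul, map_pow, aeval_X, mul_pow, ← pow_mul, mul_comm q' a]
        rw [this]
        ring
      rw [e1, AddValuation.map_mul]
      have e2 : ((a * q' : ℕ) : ℕ∞) ≤ v (y ^ (a * q')) := by
        simpa using le_addVal_pow_mul hy (a * q') 1
      refine le_trans ?_ (add_le_add e2 hrelz)
      norm_cast
      omega
    -- `T = N + δ - (l + 1) e` is the precision to which `λ` is preserved.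
    obtain ⟨T, hT⟩ : ∃ T, T + (l + 1) * e = N + δ := ⟨N + δ - (l + 1) * e, by omega⟩
    have hdT : (T : ℕ∞) ≤ v (lam' - (ζ - 1)) := by
      have := hd.2
      rw [← hT, add_comm, Nat.cast_add] at this
      exact (ENat.add_le_add_iff_left (ENat.natCast_ne_top _)).1 this
    have hE2 : ((a * q' + c * e + δ + 1 : ℕ) : ℕ∞) ≤
        v (lam' ^ a * aeval lam' U - (ζ - 1) ^ a * aeval (ζ - 1) U) := by
      have hlamq : (q' : ℕ∞) ≤ v lam' := by
        have : lam' = (lam' - (ζ - 1)) + (ζ - 1) := by ring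
        rw [this]
        exact le_addVal_add (le_trans (by exact_mod_cast hqδ) hd.1.le) hq.ge
      have := hvar (ζ - 1) lam' q' T hq.ge hlamq hdT
      rw [← ENat.add_le_add_iff_right (ENat.natCast_ne_top q')]
      refine le_trans ?_ this
      norm_cast
      omega
    rw [hx]
    have : aeval y (X ^ w * Pε) ^ p ^ c - (ζ - 1) ^ a * aeval (ζ - 1) U =
      (aeval y (X ^ w * Pε) ^ p ^ c - lam' ^ a * aeval lam' U) +
      (lam' ^ a * aeval lam' U - (ζ - 1) ^ a * aeval (ζ - 1) U) := by ring
    rw [this]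
    exact le_addVal_add hE1 hE2
  set s := (Finset.range (p ^ c)).image fun i => η ^ i * x
  have hprod : (X ^ p ^ c - C (x ^ p ^ c) : R[X]) = ∏ r ∈ s, (X - C r) := by
    rw [X_pow_sub_C_eq_prod hη hpos rfl, Finset.prod_image]
    intro i hi j hj hij
    exact hη.pow_inj (Finset.mem_range.1 hi) (Finset.mem_range.1 hj) (mul_right_cancel₀ hx0 hij)
  have hxs : x ∈ s := Finset.mem_image.2 ⟨0, Finset.mem_range.2 hpos, by simp⟩
  have hS : ∑ r ∈ s.erase x, v (x - r) = (c * e + (p ^ c - 1) * w : ℕ) := by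
    rw [← addVal_prod, ← eval_derivative_prod_X_sub_C hxs, ← hprod]
    simp only [derivative_sub, derivative_X_pow, derivative_C, sub_zero, eval_mul, eval_pow, eval_X,
      map_natCast, eval_natCast]
    rw [AddValuation.map_mul, Nat.cast_pow, AddValuation.map_pow, AddValuation.map_pow, he, hw,
      nsmul_eq_mul, nsmul_eq_mul]
    norm_cast
  have hpc : (p ^ c - 1) * w + w = a * q' := by
    rw [← hwq, mul_comm w, ← Nat.succ_mul, Nat.succ_eq_add_one, Nat.sub_add_cancel hpos]
  -- Here `S + D = c e + (p ^ c - 1) w + w + δ = a q' + c e + δ`, one less than the precision of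
  -- `hmain`.
  have := (approx_root_of_le_addVal_prod s hxs (deform π I (X ^ w * Pε))
    (by rw [eval_deform, mul_zero, add_zero, hPx]) (w + δ) _ (a * q' + c * e + δ + 1) ?_ hS.le
    (by omega) ?_ z).1
  · rwa [eval_deform, Nat.cast_add, ← hw] at this
  · intro r hr hne
    obtain ⟨i, -, rfl⟩ := Finset.mem_image.1 hr
    have h4 := addVal_sub_le_of_pow_eq_pow (n := c) (y := η ^ i * x) (x := x) he hδ hη
      (by rw [mul_pow, ← pow_mul, mul_comm i, pow_mul, hη.pow_eq_one, one_pow, one_mul]) hne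
    rw [← AddValuation.map_neg, neg_sub, Nat.cast_add, ← hw]
    exact h4
  · intro z
    have h4 := congrArg (eval (eval z (deform π I (X ^ w * Pε)))) hprod
    rw [eval_prod] at h4
    simp only [eval_sub, eval_pow, eval_X, eval_C] at h4
    rw [← h4, eval_deform]
    exact hmain z

/-- Since `g` fixes `ζ`, it fixes `x ^ p ^ c`; so `g x` is again a root of the same equation, and it
is too close to `x` to be a different one. -/
theorem apply_radical_eq [Infinite (ResidueField R)] (hπ : Irreducible π) (hI : 1 ≤ I)
    (hgen : ∀ b : R, ∃ P : W[X], aeval π P = b) (hN : ApproxRelations π I N W)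
    {l c e δ q a m : ℕ} {ζ η x : R} (hζ : IsPrimitiveRoot ζ (p ^ (l + 1)))
    (hη : IsPrimitiveRoot η (p ^ c)) {U : W[X]} (hU : IsUnit (aeval (ζ - 1) U))
    (hx : x ^ p ^ c = (ζ - 1) ^ a * aeval (ζ - 1) U) (hvar : VariationBound R a m U)
    (he : v (p : R) = e) (hδ : (p - 1) * δ = e) (hq : v (ζ - 1) = q) (h1 : (l + 1) * e < N)
    (h2 : c * e + δ < N) (h3 : (l + 1) * e + c * e + q < N + m * q)
    (g : R →ₐ[W] R) {z : R} (hz : g π = π + π ^ I * z) : g x = x := by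
  rcases eq_or_ne x 0 with rfl | hx0
  · exact map_zero g
  obtain ⟨P, hP, h⟩ := exists_deform_radical hπ hI hgen hN hζ hη hx0 hU hx hvar he hδ hq h1 h2 h3
  have hgζ := apply_isPrimitiveRoot_eq hgen hN hζ he hδ h1 g hz
  have h4 := h z
  rw [← apply_eq_aeval hP g hz] at h4
  by_contra hne
  refine absurd h4 (addVal_sub_le_of_pow_eq_pow he hδ hη ?_ hne).not_gt
  rw [← map_pow, hx, map_mul, map_pow, map_sub, map_one, ← aeval_algHom_apply, map_sub, map_one, hgζ]

end Kummer

/-! ### Generation of the ring of integers by a uniformizer. -/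

section Generation

variable {A R : Type*} [CommRing A] [CommRing R] [IsDomain R]
  [IsDiscreteValuationRing R] [Algebra A R] {π : R}

theorem exists_pow_dvd_sub_aeval (hπ : Irreducible π)
    (hres : ∀ b : R, ∃ a : A, b - algebraMap A R a ∈ maximalIdeal R) (n : ℕ) (b : R) :
    ∃ P : A[X], π ^ n ∣ b - aeval π P := by
  induction n generalizing b with
  | zero => exact ⟨0, by simp⟩
  | succ n ih =>
    obtain ⟨a, ha⟩ := hres b
    rw [hπ.maximalIdeal_eq, Ideal.mem_span_singleton] at ha
    obtain ⟨b', hb'⟩ := ha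
    obtain ⟨P, hP⟩ := ih b'
    refine ⟨C a + X * P, ?_⟩
    have : b - aeval π (C a + X * P) = π * (b' - aeval π P) := by
      simp only [map_add, aeval_C, map_mul, aeval_X]
      linear_combination hb'
    rw [this, pow_succ']
    exact mul_dvd_mul_left π hP

/-- If `A → R` induces a surjection on residue fields, a uniformizer generates `R` over `A`. -/
theorem exists_aeval_eq_of_residue_surjective [IsLocalRing A] [Module.Finite A R] (hπ : Irreducible π)
    (hres : ∀ b : R, ∃ a : A, b - algebraMap A R a ∈ maximalIdeal R) {a : A}
    (ha : a ∈ maximalIdeal A) (ha0 : algebraMap A R a ≠ 0) (b : R) :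
    ∃ P : A[X], aeval π P = b := by
  obtain ⟨n, u, hu⟩ := IsDiscreteValuationRing.eq_unit_mul_pow_irreducible ha0 hπ
  -- Nakayama: `a` is a unit times `π ^ n`, so approximation modulo `π ^ n` is approximation modulo
  -- the maximal ideal of `A`.
  have key : (⊤ : Submodule A R) ≤ LinearMap.range (aeval (R := A) π).toLinearMap := by
    refine Submodule.le_of_le_smul_of_le_jacobson_bot (I := maximalIdeal A) Module.Finite.fg_top
      (maximalIdeal_le_jacobson _) fun b _ => ?_
    obtain ⟨P, r, hr⟩ := exists_pow_dvd_sub_aeval hπ hres n b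
    have h1 : b = aeval π P + a • (((u⁻¹ : Rˣ) : R) * r) := by
      rw [Algebra.smul_def, hu]
      linear_combination hr - π ^ n * r * u.mul_inv
    rw [h1]
    exact Submodule.add_mem_sup ⟨P, rfl⟩ (Submodule.smul_mem_smul ha trivial)
  exact key (x := b) trivial

end Generation

/-! ### Conjugates of the uniformizer. -/

section Galois

theorem irreducible_smul {A K L : Type*} [CommRing A] [Field K] [Field L] [Algebra K L]
    [Algebra A K] [Algebra A L] [IsScalarTower A K L] (g : Gal(L/K)) {π : integralClosure A L}
    (hπ : Irreducible π) : Irreducible (g • π) :=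
  (MulEquiv.irreducible_iff
    (MulSemiringAction.toRingEquiv Gal(L/K) (integralClosure A L) g)).2 hπ


/-- The norm of a uniformizer of `L` has valuation `|G|` in `L`. It comes from a nonunit of `A`,
which `ϖ` divides. -/
theorem addVal_algebraMap_le_card {A : Type*} (K : Type*) {L : Type*} [CommRing A] [IsDomain A]
    [IsDiscreteValuationRing A] [Field K] [Algebra A K] [IsFractionRing A K] [Field L] [Algebra K L]
    [Algebra A L] [IsScalarTower A K L] [FiniteDimensional K L] [IsGalois K L]
    [IsDiscreteValuationRing (integralClosure A L)] {ϖ : A}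
    (hϖ : Irreducible ϖ) :
    IsDiscreteValuationRing.addVal (integralClosure A L) (algebraMap A (integralClosure A L) ϖ) ≤ Nat.card Gal(L/K) := by
  obtain ⟨π, hπ⟩ := IsDiscreteValuationRing.exists_irreducible (integralClosure A L)
  set P : (integralClosure A L) := ∏ g : Gal(L/K), g • π with hP
  have hPv : IsDiscreteValuationRing.addVal (integralClosure A L) P = Nat.card Gal(L/K) := by
    rw [hP, addVal_prod, Finset.sum_congr rfl fun g _ =>
      IsDiscreteValuationRing.addVal_uniformizer (irreducible_smul g hπ)]
    simp
  have hfix : ∀ h : Gal(L/K), h • P = P := fun h => by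
    rw [hP, Finset.smul_prod']
    simp only [smul_smul]
    exact Fintype.prod_equiv (Equiv.mulLeft h) _ _ fun g => rfl
  obtain ⟨y, hy⟩ := (IsGalois.mem_range_algebraMap_iff_fixed (F := K) (P : L)).2 fun h =>
    congrArg Subtype.val (hfix h)
  have hyint : IsIntegral A y := by
    have h1 : IsIntegral A (P : L) := P.2
    rw [← hy] at h1
    exact (isIntegral_algebraMap_iff (algebraMap K L).injective).1 h1
  obtain ⟨a, rfl⟩ := IsIntegrallyClosed.isIntegral_iff.1 hyint
  have haP : algebraMap A (integralClosure A L) a = P := Subtype.ext (by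
    rw [← hy, ← IsScalarTower.algebraMap_apply]; rfl)
  have hdvd : ϖ ∣ a := by
    by_contra h
    have hu : IsUnit a := by
      by_contra hu
      refine h (Ideal.mem_span_singleton.1 ?_)
      rw [← hϖ.maximalIdeal_eq]
      exact (mem_maximalIdeal a).2 hu
    have h1 := IsDiscreteValuationRing.addVal_eq_zero_iff.2 (haP ▸ hu.map (algebraMap A (integralClosure A L)))
    rw [hPv] at h1
    exact Nat.card_pos.ne' (by exact_mod_cast h1)
  rw [← hPv, ← haP]
  exact IsDiscreteValuationRing.addVal_le_iff_dvd.2 (map_dvd _ hdvd)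

theorem smul_uniformizer_ne {A K L : Type*} [CommRing A] [IsDomain A] [Field K] [Algebra A K]
    [IsFractionRing A K] [Field L] [Algebra K L] [Algebra A L] [IsScalarTower A K L]
    [FiniteDimensional K L] {π : integralClosure A L} (hgen : ∀ b : (integralClosure A L), ∃ P : A[X], aeval π P = b) {g : Gal(L/K)}
    (hg : g ≠ 1) : g • π ≠ π := by
  intro h
  refine hg (AlgEquiv.ext fun x => ?_)
  have hfix : ∀ b : (integralClosure A L), g • b = b := fun b => by
    obtain ⟨P, rfl⟩ := hgen b
    have : g • aeval π P = aeval (g • π) P :=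
      (aeval_algHom_apply (MulSemiringAction.toAlgHom A (integralClosure A L) g) π P).symm
    rw [this, h]
  have : IsFractionRing (integralClosure A L) L := integralClosure.isFractionRing_of_finite_extension K L
  obtain ⟨b, c, -, rfl⟩ := IsFractionRing.div_surjective (A := (integralClosure A L)) x
  have h1 : ∀ b : (integralClosure A L), g (algebraMap (integralClosure A L) L b) = algebraMap (integralClosure A L) L b := fun b =>
    congrArg Subtype.val (hfix b)
  rw [map_div₀, h1, h1]
  rfl

theorem prod_X_sub_C_dvd_of_eval_eq_zero {B ι : Type*} [CommRing B] [IsDomain B]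
    [UniqueFactorizationMonoid B] (s : Finset ι)
    (f : ι → B) (hf : Set.InjOn f s) {P : B[X]} (hP : ∀ i ∈ s, P.eval (f i) = 0) :
    ∏ i ∈ s, (X - C (f i)) ∣ P := by
  refine Finset.prod_dvd_of_isRelPrime (fun i hi k hk hik => ?_) fun i hi =>
    dvd_iff_isRoot.2 (hP i hi)
  refine ((irreducible_X_sub_C (f i)).isRelPrime_iff_not_dvd).2 fun h => ?_
  rw [dvd_iff_isRoot, IsRoot, eval_sub, eval_X, eval_C, sub_eq_zero] at h
  exact hik (hf hi hk h)

/-- `P` is divisible by `∏ (X - gπ)`. At `π + π ^ I z` the factor of `g ≠ 1` still has valuation at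
least `j g`, since `j g ≤ I`, and the factor of `g = 1` contributes `I`. -/
theorem approxRelations_of_addVal_le {A K L : Type*} [CommRing A] [IsDomain A] [Field K]
    [Algebra A K] [IsFractionRing A K] [Field L] [Algebra K L] [Algebra A L] [IsScalarTower A K L]
    [FiniteDimensional K L] [IsDiscreteValuationRing (integralClosure A L)]
    {π : integralClosure A L} (hgen : ∀ b : (integralClosure A L), ∃ P : A[X], aeval π P = b)
    (j : Gal(L/K) → ℕ) (hj : ∀ g, g ≠ 1 → IsDiscreteValuationRing.addVal (integralClosure A L) (g • π - π) = j g)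
    {I : ℕ} (hI : ∀ g, g ≠ 1 → j g ≤ I) (hπ : Irreducible π) [DecidableEq Gal(L/K)] :
    ApproxRelations π I (∑ g ∈ Finset.univ.erase (1 : Gal(L/K)), j g + I) A := by
  intro P hP z
  have hdvd : ∏ g : Gal(L/K), (X - C (g • π)) ∣ P.map (algebraMap A (integralClosure A L)) := by
    refine prod_X_sub_C_dvd_of_eval_eq_zero _ _ (fun g _ h _ hgh => ?_) fun g _ => ?_
    · by_contra hne
      refine smul_uniformizer_ne hgen (g := h⁻¹ * g) (fun h1 => hne (inv_mul_eq_one.1 h1).symm) ?_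
      have : g • π = h • π := hgh
      rw [mul_smul, this, inv_smul_smul]
    · rw [eval_map_algebraMap, show g • π = MulSemiringAction.toAlgHom A (integralClosure A L) g π from rfl,
        aeval_algHom_apply, hP, map_zero]
  have h1 := eval_dvd (x := π + π ^ I * z) hdvd
  rw [eval_map_algebraMap, ← IsDiscreteValuationRing.addVal_le_iff_dvd, eval_prod, addVal_prod,
    ← Finset.sum_erase_add _ _ (Finset.mem_univ 1)] at h1
  refine le_trans ?_ h1
  have hz : (I : ℕ∞) ≤ IsDiscreteValuationRing.addVal (integralClosure A L) (π ^ I * z) :=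
    (pow_dvd_iff_le_addVal hπ _ _).1 (dvd_mul_right _ _)
  rw [Nat.cast_add, Nat.cast_sum]
  refine add_le_add (Finset.sum_le_sum fun g hg => ?_) ?_
  · have hg' := Finset.ne_of_mem_erase hg
    rw [eval_sub, eval_X, eval_C]
    have : π + π ^ I * z - g • π = π ^ I * z - (g • π - π) := by ring
    rw [this]
    exact le_addVal_sub (le_trans (by exact_mod_cast hI g hg') hz) (hj g hg').ge
  · simpa using hz

end Galois

/-! ### The Herbrand function and upper breaks. -/

section Herbrand

variable {A K L : Type*} [CommRing A] [IsDomain A] [IsDiscreteValuationRing A]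
  [IsAdicComplete (maximalIdeal A) A] [Field K] [Algebra A K] [IsFractionRing A K]
  [Field L] [Algebra K L] [Algebra A L] [IsScalarTower A K L]
  [FiniteDimensional K L] [Algebra.IsSeparable K L]

local notation "O" => integralClosure A L

variable [IsDiscreteValuationRing (integralClosure A L)] {π : integralClosure A L}

theorem val_apply (x : O) :
    val A K L x = IsDiscreteValuationRing.addVal O x := rfl


theorem mem_lowerGroup_iff (hgen : ∀ b : O, ∃ P : A[X], aeval π P = b) (u : ℝ) (g : Gal(L/K)) :
    g ∈ lowerGroup A K L u ↔
      ((⌈u⌉₊ + 1 : ℕ) : ℕ∞) ≤ IsDiscreteValuationRing.addVal O (g • π - π) := by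
  refine ⟨fun h => h π, fun h b => ?_⟩
  obtain ⟨P, rfl⟩ := hgen b
  have : g • aeval π P = aeval (g • π) P :=
    (aeval_algHom_apply (MulSemiringAction.toAlgHom A O g) π P).symm
  rw [this, val_apply]
  exact le_addVal_aeval_sub_aeval h P

theorem integral_le_indicator {u c : ℝ} (hu : 0 ≤ u) (hc : 0 ≤ c) :
    IntervalIntegrable (Set.indicator (Set.Iic c) fun _ => (1 : ℝ)) MeasureTheory.volume 0 u ∧
      ∫ t in (0 : ℝ)..u, Set.indicator (Set.Iic c) (fun _ => (1 : ℝ)) t = min u c := by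
  constructor
  · rw [intervalIntegrable_iff_integrableOn_Ioc_of_le hu]
    refine MeasureTheory.IntegrableOn.indicator ?_ measurableSet_Iic
    exact MeasureTheory.integrableOn_const (by simp)
  · rw [intervalIntegral.integral_of_le hu, MeasureTheory.setIntegral_indicator measurableSet_Iic,
      Set.Ioc_inter_Iic]
    simp [le_min hu hc]

/-- The Herbrand function in terms of the depths `v(g π - π)`. -/
theorem herbrandPhi_eq (hgen : ∀ b : O, ∃ P : A[X], aeval π P = b)
    (j : Gal(L/K) → ℕ)
    (hj : ∀ g, g ≠ 1 → IsDiscreteValuationRing.addVal O (g • π - π) = j g) (hj1 : ∀ g, g ≠ 1 → 1 ≤ j g)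
    [DecidableEq Gal(L/K)] {u : ℝ} (hu : 0 ≤ u) :
    herbrandPhi A K L u = (Nat.card Gal(L/K) : ℝ)⁻¹ *
      (u + ∑ g ∈ Finset.univ.erase (1 : Gal(L/K)), min u ((j g : ℝ) - 1)) := by
  classical
  -- `c g` is the last `t` in `[0, u]` with `g ∈ G_t` if `g` leaves before `u`. The identity never
  -- leaves, hence the value `u`.
  set c : Gal(L/K) → ℝ := fun g => if g = 1 then u else (j g : ℝ) - 1 with hc
  have hc0 : ∀ g, 0 ≤ c g := fun g => by
    by_cases h : g = 1
    · simpa [hc, h] using hu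
    · simpa [hc, h] using hj1 g h
  have hmem : ∀ t ∈ Set.Icc 0 u, ∀ g, g ∈ lowerGroup A K L t ↔ t ≤ c g := fun t ht g => by
    by_cases h : g = 1
    · simpa [hc, h, one_mem] using ht.2
    · rw [mem_lowerGroup_iff hgen, hj g h]
      simp only [hc, h, if_false]
      rw [le_sub_iff_add_le, Nat.cast_le]
      obtain ⟨k, hk⟩ : ∃ k, j g = k + 1 := ⟨j g - 1, by have := hj1 g h; omega⟩
      rw [hk, Nat.add_le_add_iff_right, Nat.ceil_le]
      push_cast
      exact (add_le_add_iff_right 1).symm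
  have htop : lowerGroup A K L 0 = ⊤ := by
    refine (Subgroup.eq_top_iff' _).2 fun g => ?_
    by_cases h : g = 1
    · rw [h]; exact one_mem _
    · rw [mem_lowerGroup_iff hgen, hj g h]
      simpa using hj1 g h
  have hint : ∀ t ∈ Set.Icc 0 u, (((lowerGroup A K L t).relIndex (lowerGroup A K L 0) : ℕ) : ℝ)⁻¹ =
      (Nat.card Gal(L/K) : ℝ)⁻¹ * ∑ g, Set.indicator (Set.Iic (c g)) (fun _ => (1 : ℝ)) t := by
    intro t ht
    have h1 : (∑ g, Set.indicator (Set.Iic (c g)) (fun _ => (1 : ℝ)) t) =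
        Nat.card (lowerGroup A K L t) := by
      simp only [Set.indicator_apply, Set.mem_Iic, ← hmem t ht]
      rw [Finset.sum_boole, Nat.card_eq_fintype_card, Fintype.card_subtype]
    have h2 := Subgroup.card_mul_index (lowerGroup A K L t)
    have h3 : (Nat.card (lowerGroup A K L t) : ℝ) ≠ 0 := Nat.cast_ne_zero.2 Nat.card_pos.ne'
    rw [htop, Subgroup.relIndex_top_right, h1, ← h2, Nat.cast_mul, mul_inv, mul_right_comm,
      inv_mul_cancel₀ h3, one_mul]
  rw [herbrandPhi, intervalIntegral.integral_congr (g := fun t => (Nat.card Gal(L/K) : ℝ)⁻¹ *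
    ∑ g, Set.indicator (Set.Iic (c g)) (fun _ => (1 : ℝ)) t) (by rwa [Set.uIcc_of_le hu]),
    intervalIntegral.integral_const_mul,
    intervalIntegral.integral_finsetSum fun g _ => (integral_le_indicator hu (hc0 g)).1,
    Finset.sum_congr rfl fun g _ => (integral_le_indicator hu (hc0 g)).2,
    ← Finset.add_sum_erase _ _ (Finset.mem_univ 1)]
  congr 2
  · simp [hc]
  · exact Finset.sum_congr rfl fun g hg => by simp [hc, Finset.ne_of_mem_erase hg]

/-- Intermediate values: `φ(0) = 0` and `φ(n i) ≥ i`. This guarantees that `herbrandPsi` is a true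
preimage and not the default value of `Function.invFunOn`. -/
theorem herbrandPhi_surjOn (hgen : ∀ b : O, ∃ P : A[X], aeval π P = b)
    (j : Gal(L/K) → ℕ)
    (hj : ∀ g, g ≠ 1 → IsDiscreteValuationRing.addVal O (g • π - π) = j g)
    (hj1 : ∀ g, g ≠ 1 → 1 ≤ j g) {i : ℝ} (hi : 0 ≤ i) :
    ∃ u ∈ Set.Ici (0 : ℝ), herbrandPhi A K L u = i := by
  classical
  set n : ℝ := (Nat.card Gal(L/K) : ℝ)
  have hn : 0 < n := Nat.cast_pos.2 Nat.card_pos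
  have h0 : ∀ u, 0 ≤ u → 0 ≤ ∑ g ∈ Finset.univ.erase (1 : Gal(L/K)), min u ((j g : ℝ) - 1) :=
    fun u hu => Finset.sum_nonneg fun g hg => le_min hu (by
      simpa using hj1 g (Finset.ne_of_mem_erase hg))
  have hcont : ContinuousOn (fun u : ℝ => n⁻¹ *
      (u + ∑ g ∈ Finset.univ.erase (1 : Gal(L/K)), min u ((j g : ℝ) - 1))) (Set.Icc 0 (n * i)) := by
    fun_prop
  have hni : 0 ≤ n * i := by positivity
  obtain ⟨u, hu, hui⟩ := intermediate_value_Icc hni hcont (show i ∈ _ by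
    refine ⟨?_, ?_⟩
    · have : ∑ g ∈ Finset.univ.erase (1 : Gal(L/K)), min 0 ((j g : ℝ) - 1) = 0 :=
        Finset.sum_eq_zero fun g hg => min_eq_left (by simpa using hj1 g (Finset.ne_of_mem_erase hg))
      simpa [this] using hi
    · have := h0 _ hni
      calc i = n⁻¹ * (n * i) := by field_simp
        _ ≤ _ := by gcongr; linarith)
  exact ⟨u, hu.1, by rw [herbrandPhi_eq hgen j hj hj1 hu.1]; exact hui⟩

/-- A break of the upper ramification filtration at `i` gives a nontrivial automorphism `g` and a
ball around the uniformizer that contains its image under `g`, and on which all relations hold up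
to a valuation that is at least `[L : K] (i + 1)`. -/
theorem exists_approxRelations_of_upperGroup_ne_bot [IsGalois K L]
    (hπ : Irreducible π) (hgen : ∀ b : O, ∃ P : A[X], aeval π P = b) {i : ℝ} (hi : 0 ≤ i)
    (h : upperGroup A K L i ≠ ⊥) :
    ∃ (I N : ℕ) (g : Gal(L/K)) (z : O), 1 ≤ I ∧ ApproxRelations π I N A ∧ g ≠ 1 ∧
      g • π = π + π ^ I * z ∧ Nat.card Gal(L/K) * (i + 1) ≤ N := by
  classical
  set j : Gal(L/K) → ℕ := fun g => (IsDiscreteValuationRing.addVal O (g • π - π)).toNat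
  have hj : ∀ g, g ≠ 1 → IsDiscreteValuationRing.addVal O (g • π - π) = j g := fun g hg =>
    (ENat.natCast_toNat fun h => smul_uniformizer_ne hgen hg (sub_eq_zero.1
      (IsDiscreteValuationRing.addVal_eq_top_iff.1 h))).symm
  have hj1 : ∀ g, g ≠ 1 → 1 ≤ j g := fun g hg => by
    have h1 : ((1 : ℕ) : ℕ∞) ≤ IsDiscreteValuationRing.addVal O (g • π - π) :=
      le_addVal_sub (IsDiscreteValuationRing.addVal_uniformizer (irreducible_smul g hπ)).ge
        (IsDiscreteValuationRing.addVal_uniformizer hπ).ge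
    rw [hj g hg] at h1
    exact_mod_cast h1
  have hsurj := herbrandPhi_surjOn hgen j hj hj1 hi
  have hu0 : 0 ≤ herbrandPsi A K L i := Function.invFunOn_mem hsurj
  have hui : herbrandPhi A K L (herbrandPsi A K L i) = i := Function.invFunOn_eq hsurj
  set u := herbrandPsi A K L i
  obtain ⟨g', hg', hg'1⟩ := (Subgroup.ne_bot_iff_exists_ne_one (H := lowerGroup A K L u)).1 h |>.elim
    fun g hg => (⟨g.1, g.2, fun h => hg (Subtype.ext h)⟩ : ∃ g ∈ lowerGroup A K L u, g ≠ 1)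
  obtain ⟨g, hg, hmax⟩ := (Finset.univ.erase (1 : Gal(L/K))).exists_max_image j
    ⟨g', Finset.mem_erase.2 ⟨hg'1, Finset.mem_univ _⟩⟩
  have hg1 := Finset.ne_of_mem_erase hg
  have hI : ∀ g', g' ≠ 1 → j g' ≤ j g := fun g' h =>
    hmax g' (Finset.mem_erase.2 ⟨h, Finset.mem_univ _⟩)
  have hz : π ^ j g ∣ g • π - π := (pow_dvd_iff_le_addVal hπ _ _).2 (hj g hg1).ge
  obtain ⟨z, hz⟩ := hz
  refine ⟨j g, _, g, z, hj1 g hg1, approxRelations_of_addVal_le hgen j hj hI hπ, hg1,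
    by rw [← hz]; ring, ?_⟩
  rw [mem_lowerGroup_iff hgen, hj g' hg'1] at hg'
  have huI : u + 1 ≤ j g := by
    have h1 : ⌈u⌉₊ + 1 ≤ j g := le_trans (by exact_mod_cast hg') (hI g' hg'1)
    have h2 : ((⌈u⌉₊ + 1 : ℕ) : ℝ) ≤ j g := by exact_mod_cast h1
    push_cast at h2
    linarith [Nat.le_ceil u]
  -- Bounding each minimum by `j g - 1` gives `n i ≤ u + ∑ j - (n - 1)`. Adding `n` and using `u + 1
  -- ≤ I` gives `n (i + 1) ≤ N`.
  rw [herbrandPhi_eq hgen j hj hj1 hu0, inv_mul_eq_iff_eq_mul₀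
    (Nat.cast_ne_zero.2 Nat.card_pos.ne')] at hui
  rw [mul_add, ← hui, mul_one]
  have hsum : ∑ g ∈ Finset.univ.erase (1 : Gal(L/K)), min u ((j g : ℝ) - 1) ≤
      ∑ g ∈ Finset.univ.erase (1 : Gal(L/K)), ((j g : ℝ) - 1) :=
    Finset.sum_le_sum fun g _ => min_le_right _ _
  rw [Finset.sum_sub_distrib, Finset.sum_const, Finset.card_erase_of_mem (Finset.mem_univ _),
    Finset.card_univ, ← Nat.card_eq_fintype_card, nsmul_eq_mul, mul_one,
    Nat.cast_sub Nat.card_pos] at hsum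
  push_cast at hsum ⊢
  linarith

end Herbrand

/-! ### Residue fields over the Witt vectors. -/

section WittResidue

variable (p : ℕ) [Fact p.Prime] (k : Type*) [Field k] [CharP k p] [IsAlgClosed k]

theorem isAlgClosed_residueField_wittVector : IsAlgClosed (ResidueField (WittVector p k)) := by
  have hsurj : Function.Surjective (WittVector.constantCoeff (p := p) (R := k)) := fun x =>
    ⟨WittVector.teichmuller p x, WittVector.teichmuller_coeff_zero p x⟩
  have hker : RingHom.ker (WittVector.constantCoeff (p := p) (R := k)) =
      maximalIdeal (WittVector p k) :=
    eq_maximalIdeal (RingHom.ker_isMaximal_of_surjective _ hsurj)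
  exact IsAlgClosed.of_ringEquiv k _ ((RingHom.quotientKerEquivOfSurjective hsurj).symm.trans
    (Ideal.quotEquivOfEq hker))

theorem infinite_residueField_of_wittVector (R : Type*) [CommRing R] [IsDomain R] [IsDiscreteValuationRing R]
    [Algebra (WittVector p k) R] [IsLocalHom (algebraMap (WittVector p k) R)] :
    Infinite (ResidueField R) := by
  have := isAlgClosed_residueField_wittVector p k
  have : Infinite (ResidueField (WittVector p k)) := IsAlgClosed.instInfinite
  exact Infinite.of_injective _ (algebraMap (ResidueField (WittVector p k)) (ResidueField R)).injective

/-- The residue extension is integral over an algebraically closed field, hence trivial. -/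
theorem exists_sub_algebraMap_mem_maximalIdeal (R : Type*) [CommRing R] [IsDomain R] [IsDiscreteValuationRing R]
    [Algebra (WittVector p k) R] [IsLocalHom (algebraMap (WittVector p k) R)]
    [Algebra.IsIntegral (WittVector p k) R] (b : R) :
    ∃ a : WittVector p k, b - algebraMap (WittVector p k) R a ∈ maximalIdeal R := by
  have := isAlgClosed_residueField_wittVector p k
  have : Algebra.IsIntegral (ResidueField (WittVector p k)) (ResidueField R) := ⟨fun y => by
    obtain ⟨b, rfl⟩ := residue_surjective y
    exact IsIntegral.map_of_comp_eq (residue (WittVector p k)) (residue R) rfl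
      (Algebra.IsIntegral.isIntegral b)⟩
  obtain ⟨y, hy⟩ := (IsAlgClosed.algebraMap_bijective_of_isIntegral
    (k := ResidueField (WittVector p k)) (K := ResidueField R)).2 (residue R b)
  obtain ⟨a, rfl⟩ := residue_surjective y
  refine ⟨a, ?_⟩
  rw [← residue_eq_zero_iff, map_sub, ← hy]
  exact sub_eq_zero.2 rfl

end WittResidue

/-! ### Galois extensions of `K₀` with an upper break. -/

section WittExtension

variable {p : ℕ} [Fact p.Prime] {k : Type*} [Field k] [CharP k p]
  {L : Type*} [Field L] [Algebra (BaseField p k) L] [Algebra (WittVector p k) L]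
  [IsScalarTower (WittVector p k) (BaseField p k) L]

local notation "W" => WittVector p k
local notation "O" => integralClosure (WittVector p k) L

theorem algebraMap_integralClosure_injective : Function.Injective (algebraMap W O) := by
  intro x y hxy
  have h1 : Function.Injective (algebraMap W L) := by
    rw [IsScalarTower.algebraMap_eq W (BaseField p k) L]
    exact (algebraMap (BaseField p k) L).injective.comp (IsFractionRing.injective W _)
  exact h1 (congrArg Subtype.val hxy)

theorem isLocalHom_algebraMap_integralClosure : IsLocalHom (algebraMap W O) := by
  have : FaithfulSMul W O :=
    (faithfulSMul_iff_algebraMap_injective _ _).2 algebraMap_integralClosure_injective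
  infer_instance

variable [IsAlgClosed k]

theorem exists_aeval_eq_of_irreducible [FiniteDimensional (BaseField p k) L]
    [Algebra.IsSeparable (BaseField p k) L] [IsDiscreteValuationRing O] {π : O}
    (hπ : Irreducible π) (b : O) : ∃ P : (WittVector p k)[X], aeval π P = b := by
  have := IsIntegralClosure.finite W (BaseField p k) L O
  have := isLocalHom_algebraMap_integralClosure (p := p) (k := k) (L := L)
  have hirr := WittVector.irreducible p (k := k)
  refine exists_aeval_eq_of_residue_surjective hπ
    (exists_sub_algebraMap_mem_maximalIdeal p k _) (a := (p : W))
    ((mem_maximalIdeal _).2 hirr.not_isUnit) ?_ b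
  exact (map_ne_zero_iff _ algebraMap_integralClosure_injective).2 hirr.ne_zero

/-- The inequality `e ≤ [L : K₀]` suffices throughout, so total ramification is never needed as an
equality. -/
theorem exists_addVal_natCast_eq [FiniteDimensional (BaseField p k) L] [IsGalois (BaseField p k) L]
    [IsDiscreteValuationRing O] : ∃ e : ℕ, IsDiscreteValuationRing.addVal O (p : O) = e ∧ 0 < e ∧
      e ≤ Nat.card Gal(L/BaseField p k) := by
  have hirr := WittVector.irreducible p (k := k)
  have := isLocalHom_algebraMap_integralClosure (p := p) (k := k) (L := L)
  have hle := addVal_algebraMap_le_card (BaseField p k) (L := L) hirr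
  have hpO : algebraMap W O (p : W) = (p : O) := map_natCast _ _
  rw [hpO] at hle
  lift IsDiscreteValuationRing.addVal O (p : O) to ℕ using
    (hle.trans_lt (ENat.natCast_lt_top _)).ne with e he
  refine ⟨e, rfl, Nat.pos_of_ne_zero fun h => hirr.not_isUnit ?_, by exact_mod_cast hle⟩
  rw [h, Nat.cast_zero, eq_comm, IsDiscreteValuationRing.addVal_eq_zero_iff, ← hpO] at he
  exact isUnit_of_map_unit _ _ he

theorem exists_addVal_sub_one_eq {R : Type*} [CommRing R] [IsDomain R] [IsDiscreteValuationRing R]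
    {n e : ℕ} {ζ : R} (he : IsDiscreteValuationRing.addVal R (p : R) = e)
    (hζ : IsPrimitiveRoot ζ (p ^ (n + 1))) :
    ∃ q : ℕ, IsDiscreteValuationRing.addVal R (ζ - 1) = q ∧ p ^ n * (p - 1) * q = e := by
  have hp : p.Prime := Fact.out
  have h := addVal_sub_one_of_isPrimitiveRoot_prime_pow hζ
  lift IsDiscreteValuationRing.addVal R (ζ - 1) to ℕ using (fun h1 => hζ.ne_one
    (Nat.one_lt_pow (Nat.succ_ne_zero n) hp.one_lt)
    (sub_eq_zero.1 (IsDiscreteValuationRing.addVal_eq_top_iff.1 h1))) with q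
  rw [he] at h
  exact ⟨q, rfl, by exact_mod_cast h⟩

/-- If the upper ramification group at `i ≥ 0` is nontrivial and `i` exceeds the stated bounds, some
nontrivial automorphism fixes all the corresponding roots of unity and radicals. -/
theorem exists_fixing_automorphism [FiniteDimensional (BaseField p k) L]
    [IsGalois (BaseField p k) L] {d : ℕ} (hd : 1 ≤ d) {η : L} (hη : IsPrimitiveRoot η (p ^ d))
    {i : ℝ} (hi0 : 0 ≤ i) (hi : (d : ℝ) - 1 < i) (h : upperGroup W (BaseField p k) L i ≠ ⊥) :
    ∃ g : Gal(L/BaseField p k), g ≠ 1 ∧ g η = η ∧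
      ∀ (l c a m : ℕ) (U V : (WittVector p k)[X]) (ζ x : L), 1 ≤ l → l ≤ d → c ≤ d →
        IsPrimitiveRoot ζ (p ^ l) → aeval (ζ - 1) U * aeval (ζ - 1) V = 1 →
        x ^ p ^ c = (ζ - 1) ^ a * aeval (ζ - 1) U →
        (m = 0 ∨ a = 0 ∧ ∃ V' : (WittVector p k)[X], U = 1 + X ^ m * V') →
        (c : ℝ) + l - 1 - ((m : ℝ) - 1) / ((p : ℝ) ^ (l - 1) * ((p : ℝ) - 1)) < i →
        (c : ℝ) + l - 2 + 1 / ((p : ℝ) ^ (l - 1) * ((p : ℝ) - 1)) < i → g x = x := by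
  have hp : p.Prime := Fact.out
  have hp1 : (1 : ℝ) < p := by exact_mod_cast hp.one_lt
  have : IsDiscreteValuationRing O :=
    isDiscreteValuationRing_integralClosure W (BaseField p k) L
  have := isLocalHom_algebraMap_integralClosure (p := p) (k := k) (L := L)
  have := infinite_residueField_of_wittVector p k O
  obtain ⟨π, hπ⟩ := IsDiscreteValuationRing.exists_irreducible O
  have hgen := exists_aeval_eq_of_irreducible hπ
  obtain ⟨I, N, g, z, hI, hN, hg1, hz, hiN⟩ :=
    exists_approxRelations_of_upperGroup_ne_bot hπ hgen hi0 h
  obtain ⟨e, he, he0, hen⟩ := exists_addVal_natCast_eq (p := p) (k := k) (L := L)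
  have hbound : ∀ r : ℝ, r < i + 1 → e * r < N := fun r hr => by
    have h1 : (e : ℝ) ≤ Nat.card Gal(L/BaseField p k) := by exact_mod_cast hen
    have h2 : (0 : ℝ) < e := by exact_mod_cast he0
    calc e * r < e * (i + 1) := by gcongr
      _ ≤ Nat.card Gal(L/BaseField p k) * (i + 1) := by gcongr
      _ ≤ N := hiN
  have hinj : Function.Injective (algebraMap O L) := Subtype.val_injective
  have hlift : ∀ {n : ℕ} {ζ : L}, 1 ≤ n → IsPrimitiveRoot ζ (p ^ n) →
      ∃ ζ' : O, (ζ' : L) = ζ ∧ IsPrimitiveRoot ζ' (p ^ n) := fun {n ζ} hn hζ =>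
    ⟨⟨ζ, (hζ.isIntegral (pow_pos hp.pos n)).tower_top⟩, rfl,
      IsPrimitiveRoot.of_map_of_injective (f := algebraMap O L) hζ hinj⟩
  obtain ⟨d, rfl⟩ : ∃ d', d = d' + 1 := ⟨d - 1, by omega⟩
  obtain ⟨η', rfl, hη'⟩ := hlift hd hη
  obtain ⟨δ, -, hδ⟩ := exists_addVal_sub_one_eq (n := 0) (p := p) he
    (hη'.pow (pow_pos hp.pos _) (a := p ^ d) (b := p ^ (0 + 1)) (by ring))
  rw [pow_zero, one_mul] at hδ
  have hdN : (d + 1) * e < N := by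
    have := hbound (d + 1) (by push_cast at hi; linarith)
    have h2 : (((d + 1) * e : ℕ) : ℝ) < N := by push_cast; linarith
    exact_mod_cast h2
  refine ⟨g, hg1, congrArg Subtype.val (apply_isPrimitiveRoot_eq hgen hN hη' he hδ hdN
    (MulSemiringAction.toAlgHom W O g) hz), ?_⟩
  intro l c a m U V ζ x hl hld hcd hζ hUV hx hm hi1 hi2
  obtain ⟨l, rfl⟩ : ∃ l', l = l' + 1 := ⟨l - 1, by omega⟩
  obtain ⟨ζ', rfl, hζ'⟩ := hlift hl hζ
  obtain ⟨q, hq, hqe⟩ := exists_addVal_sub_one_eq he hζ'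
  have hcoe : ∀ P : (WittVector p k)[X], aeval ((ζ' : L) - 1) P = ((aeval (ζ' - 1) P : O) : L) :=
    fun P => aeval_algHom_apply (integralClosure W L).val (ζ' - 1) P
  have hxint : IsIntegral W x := by
    refine IsIntegral.of_pow (pow_pos hp.pos c) ?_
    rw [hx, hcoe]
    exact ((ζ' - 1) ^ a * aeval (ζ' - 1) U : O).2
  obtain ⟨x, rfl⟩ : ∃ x' : O, (x' : L) = x := ⟨⟨x, hxint⟩, rfl⟩
  have hU : IsUnit (aeval (ζ' - 1) U) := by
    refine IsUnit.of_mul_eq_one (aeval (ζ' - 1) V) (hinj ?_)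
    rw [hcoe, hcoe] at hUV
    exact hUV
  have hx' : x ^ p ^ c = (ζ' - 1) ^ a * aeval (ζ' - 1) U := by
    refine hinj ?_
    rw [hcoe] at hx
    exact hx
  have hvar : VariationBound O a m U := by
    rcases hm with rfl | ⟨rfl, V', rfl⟩
    · exact variationBound_zero a U
    · exact variationBound_one_add m V'
  have hηc : IsPrimitiveRoot (η' ^ p ^ (d + 1 - c)) (p ^ c) :=
    hη'.pow (pow_pos hp.pos _) (by rw [← pow_add, Nat.sub_add_cancel hcd])
  have hlN : (l + 1) * e < N := lt_of_le_of_lt (Nat.mul_le_mul_right e hld) hdN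
  have hp1' : (0 : ℝ) < (p : ℝ) - 1 := by linarith
  have hδ' : ((p : ℝ) - 1) * δ = e := by
    rw [← hδ, Nat.cast_mul, Nat.cast_sub hp.one_lt.le, Nat.cast_one]
  have hqe' : (p : ℝ) ^ l * ((p : ℝ) - 1) * q = e := by
    rw [← hqe, Nat.cast_mul, Nat.cast_mul, Nat.cast_sub hp.one_lt.le, Nat.cast_one, Nat.cast_pow]
  rw [Nat.add_sub_cancel] at hi1 hi2
  set E : ℝ := (p : ℝ) ^ l * ((p : ℝ) - 1) with hE
  have hE0 : 0 < E := by positivity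
  push_cast at hi1 hi2
  -- Divided by `e` this asks for `c + 1 / (p - 1) < i + 1`. That is exactly the third bound for
  -- level one, and follows from it at higher levels because `1 / (p - 1) ≤ 1`.
  have hcN : c * e + δ < N := by
    have h1 : (c : ℝ) + 1 / ((p : ℝ) - 1) ≤ c + (l + 1) - 2 + 1 / E + 1 := by
      rcases Nat.eq_zero_or_pos l with rfl | hl
      · simp only [hE, pow_zero, one_mul, Nat.cast_zero]
        linarith
      · have h2 : (1 : ℝ) ≤ l := by exact_mod_cast hl
        have h3 : (1 : ℝ) / ((p : ℝ) - 1) ≤ 1 := by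
          rw [div_le_one hp1']
          have : (2 : ℝ) ≤ p := by exact_mod_cast hp.two_le
          linarith
        have : 0 ≤ 1 / E := by positivity
        linarith
    have h2 := hbound _ (lt_of_le_of_lt h1 (by linarith))
    have h3 : (e : ℝ) * (c + 1 / ((p : ℝ) - 1)) = c * e + δ := by
      rw [← hδ']; field_simp
    rw [h3] at h2
    exact_mod_cast h2
  -- Since `q = e / E`, this is the second bound multiplied by `e`.
  have hmN : (l + 1) * e + c * e + q < N + m * q := by
    have h2 := hbound (c + (l + 1) - ((m : ℝ) - 1) / E) (by linarith)
    have h3 : (e : ℝ) * (c + (l + 1) - ((m : ℝ) - 1) / E) = (l + 1) * e + c * e + q - m * q := by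
      rw [← hqe']; field_simp; ring
    rw [h3] at h2
    have h4 : (((l + 1) * e + c * e + q : ℕ) : ℝ) < ((N + m * q : ℕ) : ℝ) := by
      push_cast; linarith
    exact_mod_cast h4
  exact congrArg Subtype.val (apply_radical_eq hπ hI hgen hN hζ' hηc hU hx' hvar he hδ hq hlN hcN hmN
    (MulSemiringAction.toAlgHom W O g) hz)

end WittExtension

/-- Polynomials over `W` are used so that the expansion can be transported by any `W`-embedding; `V`
records that `U(ϖ)` is a unit. If `t` has positive valuation, `α` is a unit and `a = 0`. -/
theorem exists_uniformizer_expansion {W R : Type*} [CommRing W] [CommRing R] [IsDomain R]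
    [IsDiscreteValuationRing R] [Algebra W R] {ϖ : R} (hϖ : Irreducible ϖ)
    (hgen : ∀ b : R, ∃ P : W[X], aeval ϖ P = b) {α t : R} (ht : α = 1 + t) (hα0 : α ≠ 0)
    (ht0 : t ≠ 0) :
    ∃ (a : ℕ) (U V : W[X]), aeval ϖ U * aeval ϖ V = 1 ∧ α = ϖ ^ a * aeval ϖ U ∧
      ((IsDiscreteValuationRing.addVal R t).toNat = 0 ∨
        a = 0 ∧ ∃ V', U = 1 + X ^ (IsDiscreteValuationRing.addVal R t).toNat * V') := by
  obtain ⟨m, u, hu⟩ := IsDiscreteValuationRing.eq_unit_mul_pow_irreducible ht0 hϖ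
  have hm : (IsDiscreteValuationRing.addVal R t).toNat = m := by
    rw [hu, IsDiscreteValuationRing.addVal_def' _ hϖ, ENat.toNat_natCast]
  rw [hm]
  rcases Nat.eq_zero_or_pos m with rfl | hm0
  · obtain ⟨a, w, hw⟩ := IsDiscreteValuationRing.eq_unit_mul_pow_irreducible hα0 hϖ
    obtain ⟨U, hU⟩ := hgen w
    obtain ⟨V, hV⟩ := hgen (w⁻¹ : Rˣ)
    exact ⟨a, U, V, by rw [hU, hV, Units.mul_inv], by rw [hU, hw, mul_comm], Or.inl rfl⟩
  · obtain ⟨V', hV'⟩ := hgen u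
    have hα : aeval ϖ (1 + X ^ m * V' : W[X]) = α := by
      rw [map_add, map_one, map_mul, map_pow, aeval_X, hV', ht, hu, mul_comm]
    have hunit : IsUnit α := by
      have ht' : t ∈ maximalIdeal R := by
        rw [hϖ.maximalIdeal_eq, Ideal.mem_span_singleton, hu]
        exact dvd_mul_of_dvd_right (dvd_pow_self _ hm0.ne') _
      by_contra h
      have h1 := Ideal.sub_mem _ ((mem_maximalIdeal α).2 h) ht'
      rw [ht, add_sub_cancel_right] at h1
      exact (mem_maximalIdeal (1 : R)).1 h1 isUnit_one
    obtain ⟨w, hw⟩ := hunit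
    obtain ⟨V, hV⟩ := hgen (w⁻¹ : Rˣ)
    exact ⟨0, _, V, by rw [hα, hV, ← hw, Units.mul_inv], by rw [hα, pow_zero, one_mul],
      Or.inr ⟨rfl, V', rfl⟩⟩

/-! ### The cyclotomic layers. -/

section Cyclotomic

variable {p : ℕ} [Fact p.Prime] {k : Type*} [Field k] [CharP k p]

theorem exists_isPrimitiveRoot_closedField (n : ℕ) :
    ∃ ζ : ClosedField p k, IsPrimitiveRoot ζ (p ^ n) := by
  have : NeZero (p : BaseField p k) := ⟨Nat.cast_ne_zero.2 (Fact.out : p.Prime).ne_zero⟩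
  exact HasEnoughRootsOfUnity.exists_primitiveRoot _ _

theorem cyclotomicLayer_eq_adjoin {n : ℕ} {ζ : ClosedField p k} (hζ : IsPrimitiveRoot ζ (p ^ n)) :
    cyclotomicLayer p k n = IntermediateField.adjoin (BaseField p k) {ζ} := by
  have : NeZero (p ^ n) := ⟨pow_ne_zero n (Fact.out : p.Prime).ne_zero⟩
  refine le_antisymm (IntermediateField.adjoin_le_iff.2 fun z hz => ?_)
    (IntermediateField.adjoin_le_iff.2 ?_)
  · obtain ⟨j, -, rfl⟩ := hζ.eq_pow_of_pow_eq_one hz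
    exact pow_mem (IntermediateField.mem_adjoin_simple_self _ _) j
  · rintro _ rfl
    exact IntermediateField.subset_adjoin _ _ hζ.pow_eq_one

theorem mem_cyclotomicLayer {n : ℕ} {ζ : ClosedField p k} (hζ : ζ ^ p ^ n = 1) :
    ζ ∈ cyclotomicLayer p k n :=
  IntermediateField.subset_adjoin _ _ hζ

theorem isCyclotomicExtension_cyclotomicLayer (n : ℕ) :
    IsCyclotomicExtension {p ^ n} (BaseField p k) (cyclotomicLayer p k n) := by
  have : NeZero (p ^ n) := ⟨pow_ne_zero n (Fact.out : p.Prime).ne_zero⟩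
  obtain ⟨ζ, hζ⟩ := exists_isPrimitiveRoot_closedField (p := p) (k := k) n
  rw [cyclotomicLayer_eq_adjoin hζ]
  exact hζ.intermediateField_adjoin_isCyclotomicExtension _

theorem isGalois_cyclotomicLayer (n : ℕ) : IsGalois (BaseField p k) (cyclotomicLayer p k n) := by
  have := isCyclotomicExtension_cyclotomicLayer (p := p) (k := k) n
  exact IsCyclotomicExtension.isGalois {p ^ n} _ _

/-- In the `p ^ (n + 1)`-th cyclotomic extension `L` of `K₀`, `ζ - 1` is a uniformizer. -/
theorem irreducible_sub_one [IsAlgClosed k] {n : ℕ} {L : Type*} [Field L]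
    [Algebra (BaseField p k) L] [Algebra (WittVector p k) L]
    [IsScalarTower (WittVector p k) (BaseField p k) L] [FiniteDimensional (BaseField p k) L]
    [IsGalois (BaseField p k) L] [IsCyclotomicExtension {p ^ (n + 1)} (BaseField p k) L]
    [IsDiscreteValuationRing (integralClosure (WittVector p k) L)]
    {ζ : integralClosure (WittVector p k) L}
    (hζ : IsPrimitiveRoot ζ (p ^ (n + 1))) : Irreducible (ζ - 1) := by
  have hp : p.Prime := Fact.out
  obtain ⟨e, he, he0, hle⟩ := exists_addVal_natCast_eq (p := p) (k := k) (L := L)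
  obtain ⟨q, hq, hqe⟩ := exists_addVal_sub_one_eq he hζ
  have hζ' : IsPrimitiveRoot (ζ : L) (p ^ (n + 1)) :=
    hζ.map_of_injective (f := algebraMap _ L) Subtype.val_injective
  have : NeZero (p ^ (n + 1)) := ⟨pow_ne_zero _ hp.ne_zero⟩
  -- The Galois group embeds in the units modulo `p ^ (n + 1)`, so `p ^ n (p - 1) q = e ≤ p ^ n (p -
  -- 1)` and `q ≤ 1`.
  have h1 := hle.trans (Nat.card_le_card_of_injective _ (hζ'.autToPow_injective (BaseField p k)))
  rw [Nat.card_eq_fintype_card (α := (ZMod (p ^ (n + 1)))ˣ), ZMod.card_units_eq_totient] at h1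
  rw [Nat.totient_prime_pow_succ hp, ← hqe] at h1
  have h2 : 0 < p ^ n * (p - 1) := Nat.mul_pos (pow_pos hp.pos n) (Nat.sub_pos_of_lt hp.one_lt)
  have h3 : q ≤ 1 := Nat.le_of_mul_le_mul_left (by rwa [mul_one]) h2
  have h4 : q ≠ 0 := by
    rintro rfl
    omega
  obtain rfl : q = 1 := by omega
  obtain ⟨π, hπ⟩ := IsDiscreteValuationRing.exists_irreducible
    (integralClosure (WittVector p k) L)
  refine ((IsDiscreteValuationRing.addVal_eq_iff_associated _ _).1 ?_).irreducible hπ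
  rw [hq, IsDiscreteValuationRing.addVal_uniformizer hπ, Nat.cast_one]

end Cyclotomic

/-! ### Generators of the Galois closure and the conductor bound. -/

section KummerClosure

variable {p : ℕ} [Fact p.Prime] {k : Type*} [Field k] [CharP k p] {d : ℕ} {x : ClosedField p k}

local notation "K₀" => BaseField p k
local notation "Ω" => ClosedField p k

theorem kummerLayer_map_le_kummerClosure (σ : Gal(Ω/K₀)) :
    (kummerLayer p k d x).map (σ : Ω →ₐ[K₀] Ω) ≤ kummerClosure p k d x := by
  rw [kummerClosure, IntermediateField.normalClosure_def'']
  exact le_iSup (fun σ : Gal(Ω/K₀) => (kummerLayer p k d x).map (σ : Ω →ₐ[K₀] Ω)) σ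

theorem apply_mem_kummerClosure (σ : Gal(Ω/K₀)) : σ x ∈ kummerClosure p k d x :=
  kummerLayer_map_le_kummerClosure σ ⟨x, (le_sup_right : _ ≤ kummerLayer p k d x)
    (IntermediateField.mem_adjoin_simple_self _ x), rfl⟩

theorem mem_kummerClosure_of_pow_eq_one {ζ : Ω} (hζ : ζ ^ p ^ d = 1) :
    ζ ∈ kummerClosure p k d x :=
  kummerLayer_map_le_kummerClosure 1 ⟨ζ, (le_sup_left : _ ≤ kummerLayer p k d x)
    (mem_cyclotomicLayer hζ), rfl⟩

theorem isGalois_kummerClosure : IsGalois K₀ (kummerClosure p k d x) := by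
  have : Normal K₀ (kummerClosure p k d x) :=
    normalClosure.normal K₀ (kummerLayer p k d x) Ω
  exact ⟨⟩

/-- The closure is the compositum of the conjugates of `K_d(x)`. Each is generated by a power of `η`
and some `σ x`, so it lies in the fixed field of `g`. -/
theorem eq_one_of_apply_eq {η : kummerClosure p k d x} (hη : IsPrimitiveRoot η (p ^ d))
    {g : Gal(kummerClosure p k d x/K₀)} (hgη : g η = η)
    (hgx : ∀ σ : Gal(Ω/K₀), g ⟨σ x, apply_mem_kummerClosure σ⟩ = ⟨σ x, apply_mem_kummerClosure σ⟩) :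
    g = 1 := by
  set F : IntermediateField K₀ Ω := IntermediateField.lift
    (IntermediateField.fixedField (Subgroup.zpowers g)) with hF
  have hmem : ∀ y : kummerClosure p k d x, (y : Ω) ∈ F ↔ g y = y := fun y => by
    rw [hF, IntermediateField.mem_lift, IntermediateField.mem_fixedField_iff]
    refine ⟨fun h => h g (Subgroup.mem_zpowers g), fun h f hf => ?_⟩
    have h1 : g ∈ MulAction.stabilizer Gal(kummerClosure p k d x/K₀) y := h
    exact (Subgroup.zpowers_le.2 h1) hf
  have hle : kummerClosure p k d x ≤ F := by
    conv_lhs => rw [kummerClosure, IntermediateField.normalClosure_def'']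
    refine iSup_le fun σ => ?_
    have hηΩ : IsPrimitiveRoot (η : Ω) (p ^ d) :=
      hη.map_of_injective (f := algebraMap (kummerClosure p k d x) Ω) Subtype.val_injective
    rw [kummerLayer, IntermediateField.map_sup, cyclotomicLayer_eq_adjoin hηΩ,
      IntermediateField.adjoin_map, IntermediateField.adjoin_map, Set.image_singleton,
      Set.image_singleton, sup_le_iff, IntermediateField.adjoin_le_iff,
      IntermediateField.adjoin_le_iff, Set.singleton_subset_iff, Set.singleton_subset_iff]
    have : NeZero (p ^ d) := ⟨pow_ne_zero d (Fact.out : p.Prime).ne_zero⟩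
    obtain ⟨j, -, hj⟩ := hηΩ.eq_pow_of_pow_eq_one (ξ := σ η)
      (by rw [← map_pow, hηΩ.pow_eq_one, map_one])
    refine ⟨?_, (hmem _).2 (hgx σ)⟩
    have h1 : (η : Ω) ^ j ∈ F := pow_mem ((hmem _).2 hgη) j
    rw [hj] at h1
    exact h1
  exact AlgEquiv.ext fun y => (hmem y).1 (hle y.2)

end KummerClosure

/-- Above the stated bounds, the upper ramification groups of the Galois closure of
`K_d(α ^ (1 / p ^ c))` are trivial. -/
theorem upperGroup_kummerClosure_eq_bot {p : ℕ} [Fact p.Prime] {k : Type*} [Field k]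
    [CharP k p] [IsAlgClosed k] {l c d : ℕ} (hl : 1 ≤ l) (hd : max l c ≤ d)
    {α t : integralClosure (WittVector p k) (cyclotomicLayer p k l)}
    (ht : α = 1 + t) {x : ClosedField p k}
    (hx : x ^ p ^ c = ((α : cyclotomicLayer p k l) : ClosedField p k)) {i : ℝ} (hi0 : 0 ≤ i)
    (hid : (d : ℝ) - 1 < i)
    (hi1 : t ≠ 0 → (c : ℝ) + l - 1 - (((val (WittVector p k) (BaseField p k)
      (cyclotomicLayer p k l) t).toNat : ℝ) - 1) / ((p : ℝ) ^ (l - 1) * ((p : ℝ) - 1)) < i)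
    (hi2 : (c : ℝ) + l - 2 + 1 / ((p : ℝ) ^ (l - 1) * ((p : ℝ) - 1)) < i) :
    upperGroup (WittVector p k) (BaseField p k) (kummerClosure p k d x) i = ⊥ := by
  by_contra h
  have hp : p.Prime := Fact.out
  have hld := (le_max_left _ _).trans hd
  have hcd := (le_max_right _ _).trans hd
  have := isGalois_kummerClosure (p := p) (k := k) (d := d) (x := x)
  obtain ⟨η, hη⟩ : ∃ η : kummerClosure p k d x, IsPrimitiveRoot η (p ^ d) := by
    obtain ⟨ζ, hζ⟩ := exists_isPrimitiveRoot_closedField (p := p) (k := k) d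
    exact ⟨⟨ζ, mem_kummerClosure_of_pow_eq_one hζ.pow_eq_one⟩, IsPrimitiveRoot.of_map_of_injective
      (f := algebraMap (kummerClosure p k d x) (ClosedField p k)) hζ Subtype.val_injective⟩
  obtain ⟨g, hg1, hgη, hg⟩ := exists_fixing_automorphism (hl.trans hld) hη hi0 hid h
  refine hg1 (eq_one_of_apply_eq hη hgη fun σ => ?_)
  by_cases hα0 : α = 0
  · have hx0 : x = 0 := by
      rw [hα0] at hx
      exact pow_eq_zero_iff (pow_pos hp.pos c).ne' |>.1 (by simpa using hx)
    have h0 : (⟨σ x, apply_mem_kummerClosure σ⟩ : kummerClosure p k d x) = 0 :=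
      Subtype.ext (by simp [hx0])
    rw [h0, map_zero]
  -- Here `x` is itself a root of unity of order dividing `p ^ d`, so only the cyclotomic part is
  -- needed.
  by_cases ht0 : t = 0
  · have hx1 : x ^ p ^ c = 1 := by rw [hx, ht, ht0]; simp
    have : NeZero (p ^ d) := ⟨pow_ne_zero d hp.ne_zero⟩
    obtain ⟨j, -, hj⟩ := hη.eq_pow_of_pow_eq_one
      (ξ := (⟨σ x, apply_mem_kummerClosure σ⟩ : kummerClosure p k d x)) (Subtype.ext (by
        obtain ⟨s, rfl⟩ := Nat.exists_eq_add_of_le hcd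
        simp [pow_add, pow_mul, ← map_pow, hx1]))
    rw [← hj, map_pow, hgη]
  have hDVR : IsDiscreteValuationRing (integralClosure (WittVector p k) (cyclotomicLayer p k l)) :=
    isDiscreteValuationRing_integralClosure (WittVector p k) (BaseField p k) _
  obtain ⟨ζ, hζ⟩ := exists_isPrimitiveRoot_closedField (p := p) (k := k) l
  obtain ⟨l, rfl⟩ : ∃ l', l = l' + 1 := ⟨l - 1, by omega⟩
  obtain ⟨ζ, rfl⟩ : ∃ ζ' : integralClosure (WittVector p k) (cyclotomicLayer p k (l + 1)),
      ((ζ' : cyclotomicLayer p k (l + 1)) : ClosedField p k) = ζ :=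
    ⟨⟨⟨ζ, mem_cyclotomicLayer hζ.pow_eq_one⟩,
      IsIntegral.of_pow (pow_pos hp.pos (l + 1)) (by
        convert isIntegral_one
        exact Subtype.ext hζ.pow_eq_one)⟩, rfl⟩
  have hζO : IsPrimitiveRoot ζ (p ^ (l + 1)) := by
    refine IsPrimitiveRoot.of_map_of_injective (f := ((algebraMap (cyclotomicLayer p k (l + 1))
      (ClosedField p k)).comp (algebraMap (integralClosure (WittVector p k)
        (cyclotomicLayer p k (l + 1))) (cyclotomicLayer p k (l + 1))))) hζ ?_
    exact Subtype.val_injective.comp Subtype.val_injective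
  have := isCyclotomicExtension_cyclotomicLayer (p := p) (k := k) (l + 1)
  have := isGalois_cyclotomicLayer (p := p) (k := k) (l + 1)
  have hirr := irreducible_sub_one hζO
  obtain ⟨a, U, V, hUV, hαU, hm⟩ := exists_uniformizer_expansion hirr
    (exists_aeval_eq_of_irreducible hirr) ht hα0 ht0
  -- Applying `σ` to the expansion of `α` exhibits `σ x` as a radical of `(σ ζ - 1) ^ a U(σ ζ - 1)`,
  -- with the same `U`.
  let φ : integralClosure (WittVector p k) (cyclotomicLayer p k (l + 1)) →ₐ[WittVector p k]
      ClosedField p k := ((σ : ClosedField p k →ₐ[BaseField p k] ClosedField p k).restrictScalars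
    (WittVector p k)).comp (((cyclotomicLayer p k (l + 1)).val.restrictScalars
      (WittVector p k)).comp (integralClosure (WittVector p k) (cyclotomicLayer p k (l + 1))).val)
  have hφinj : Function.Injective φ :=
    σ.injective.comp (Subtype.val_injective.comp Subtype.val_injective)
  have hφζ : IsPrimitiveRoot (φ ζ) (p ^ (l + 1)) := hζO.map_of_injective hφinj
  have hφζd : φ ζ ^ p ^ d = 1 := by
    obtain ⟨s, rfl⟩ := Nat.exists_eq_add_of_le hld
    rw [pow_add, pow_mul, hφζ.pow_eq_one, one_pow]
  set ζL : kummerClosure p k d x := ⟨φ ζ, mem_kummerClosure_of_pow_eq_one hφζd⟩ with hζL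
  let ι : kummerClosure p k d x →ₐ[WittVector p k] ClosedField p k :=
    (kummerClosure p k d x).val.restrictScalars (WittVector p k)
  have hιinj : Function.Injective ι := Subtype.val_injective
  have hcoe : ∀ P : (WittVector p k)[X], ι (aeval (ζL - 1) P) = φ (aeval (ζ - 1) P) := fun P => by
    rw [← aeval_algHom_apply, ← aeval_algHom_apply, map_sub, map_sub, map_one, map_one]
    rfl
  refine hg (l + 1) c a _ U V ζL _ hl hld hcd
    (IsPrimitiveRoot.of_map_of_injective (f := ι) hφζ hιinj) (hιinj ?_) (hιinj ?_) hm (hi1 ht0) hi2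
  · rw [map_mul, hcoe, hcoe, ← map_mul, hUV, map_one, map_one]
  · have h1 : ι ⟨σ x, apply_mem_kummerClosure σ⟩ = σ x := rfl
    have h2 : ι ζL = φ ζ := rfl
    have h3 : φ α = σ ((α : cyclotomicLayer p k (l + 1)) : ClosedField p k) := rfl
    rw [map_pow, map_mul, map_pow, map_sub, map_one, hcoe, h1, h2, ← map_pow, hx, ← h3, hαU,
      map_mul, map_pow, map_sub, map_one]

end LocalRamification

theorem corollary4p4 (p : ℕ) [Fact p.Prime] (k : Type*) [Field k] [CharP k p] [IsAlgClosed k]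
    (l c d : ℕ) (hl : 1 ≤ l) (hc : 1 ≤ c) (hd : max l c ≤ d)
    (α t : integralClosure (WittVector p k) (LocalRamification.cyclotomicLayer p k l))
    (ht : α = 1 + t)
    (x : LocalRamification.ClosedField p k)
    (hx : x ^ p ^ c = ((α : LocalRamification.cyclotomicLayer p k l) :
      LocalRamification.ClosedField p k)) :
    (t ≠ 0 →
      LocalRamification.ramConductor (WittVector p k) (LocalRamification.BaseField p k)
          (LocalRamification.kummerClosure p k d x) ≤
        ENNReal.ofReal (max (max ((d : ℝ) - 1)
          ((c : ℝ) + l - 1 -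
            (((LocalRamification.val (WittVector p k) (LocalRamification.BaseField p k)
              (LocalRamification.cyclotomicLayer p k l) t).toNat : ℝ) - 1) /
                ((p : ℝ) ^ (l - 1) * ((p : ℝ) - 1))))
          ((c : ℝ) + l - 2 + 1 / ((p : ℝ) ^ (l - 1) * ((p : ℝ) - 1))))) ∧
    (t = 0 →
      LocalRamification.ramConductor (WittVector p k) (LocalRamification.BaseField p k)
          (LocalRamification.kummerClosure p k d x) ≤
        ENNReal.ofReal (max ((d : ℝ) - 1)
          ((c : ℝ) + l - 2 + 1 / ((p : ℝ) ^ (l - 1) * ((p : ℝ) - 1))))) := by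
  -- The truncation in `ENNReal.ofReal` loses nothing: `d ≥ 1` makes the maximum nonnegative.
  refine ⟨fun ht0 => iSup₂_le fun i hi => ENNReal.ofReal_le_ofReal ?_,
    fun ht0 => iSup₂_le fun i hi => ENNReal.ofReal_le_ofReal ?_⟩
  · by_contra! h
    rw [max_lt_iff, max_lt_iff] at h
    exact hi.2 (LocalRamification.upperGroup_kummerClosure_eq_bot hl hd ht hx hi.1 h.1.1
      (fun _ => h.1.2) h.2)
  · by_contra! h
    rw [max_lt_iff] at h
    exact hi.2 (LocalRamification.upperGroup_kummerClosure_eq_bot hl hd ht hx hi.1 h.1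
      (fun h0 => absurd ht0 h0) h.2)
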